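/- Let $M$ be a connected smooth manifold of dimension $4n\ge 8$ and let $Q\subset\mathrm{End}(TM)$ be an almost quaternionic structure, i.e. a rank three subbundle locally generated by smooth almost complex structures $J_1,J_2,J_3$ with $J_1J_2=J_3=-J_2J_1$ (an admissible basis). Let $D$ be a quaternionic connection on $(M,Q)$, i.e. a torsion-free linear connection on $M$ which preserves $Q$, and assume that $D$ is self-dual: the curvature $R$ of the connection induced by $D$ on $\Lambda^{4n}(T^*M)$ satisfies $R_{JX,JY}=R_{X,Y}$ for every $J\in Q$ with $J^2=-\mathrm{Id}$. Let $\pi:Z\to M$ be the twistor space, $Z_p=\{J\in Q_p: J^2=-\mathrm{Id}\}$. It carries the complex structure $\mathcal J$ which, at $J\in Z_p$, acts as $J$ on the $D$-horizontal space (identified with $T_pM$ by $\pi_*$) and as $B\mapsto J\circ B$ on the vertical space $T_JZ_p=\{B\in Q_p: BJ=-JB\}$. Let $\Theta\to Z$ be the vertical tangent bundle, $\Theta_J=T_JZ_{\pi(J)}\subset Q_{\pi(J)}$, a complex line bundle with the fibrewise complex structure $B\mapsto J\circ B$, also denoted by $\mathcal J$; let $\Pi_J(B)=\frac12(B+J\circ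 B\circ J)$ be the projection of $Q_{\pi(J)}$ onto $\Theta_J$, and let $\nabla=\Pi\circ\pi^*D$ be the induced connection on $\Theta$. The operator $\bar\partial^D$ is the $(0,1)$-part of $\nabla$: $\bar\partial^D_Us=\frac12(\nabla_Us+\mathcal J\nabla_{\mathcal JU}s)$ for $U\in TZ$ and $s\in\Gamma(\Theta)$. A section $A\in\Gamma(Q)$ defines the distinguished section $\tilde A\in\Gamma(\Theta)$, $\tilde A(J)=\Pi_J(A)$. Let $H=\mathbb C^2$ be the standard representation of $Sp(1)=SU(2)$, with invariant symplectic form $\omega$ (by which $H\cong H^*$) and hermitian metric. Write locally $TM\otimes\mathbb C=\mathbf E\otimes\mathbf H$, where the elements of $Q$ act trivially on $\mathbf E$ and as $\mathfrak{sp}(1)\subset S^2(H)\subset\mathrm{End}(H)$ on $\mathbf H$, so that $Q\otimes\mathbb C=S^2(\mathbf H)$. Then $T^*M\otimes Q$ (complexified) is $\mathbf E^*\otimes\mathbf H\otimes S^2(\mathbf H)=\mathbf E^*\otimes S^3(\mathbf H)\oplus\mathbf E^*\otimes\mathbf H$, where $S^3(H)$ is the kernel of $F:H\otimes S^2(H)\to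 H$, $F(h,h_1h_2+h_2h_1)=\omega(h,h_1)h_2+\omega(h,h_2)h_1$, and the second summand corresponds to the hermitian orthogonal of $S^3(H)$ in $H\otimes S^2(H)$. The Penrose operator $P^D:\Gamma(Q)\to\Gamma(\mathbf E^*\otimes S^3(\mathbf H))$ is the composition of $D:\Gamma(Q)\to\Gamma(T^*M\otimes Q)$ with the projection onto the first summand. Then, for every $A\in\Gamma(Q)$, the distinguished section $\tilde A$ of $\Theta$ is $\bar\partial^D$-holomorphic (i.e. $\bar\partial^D\tilde A=0$) if and only if $P^DA=0$. -/

import Mathlib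

open Bundle Set FiberBundle
open scoped Manifold ContDiff Topology TensorProduct

noncomputable section

namespace QuatTwistor

/-! ## The induced connection on the endomorphism bundle -/

section Geometry

variable {E : Type*} [NormedAddCommGroup E] [NormedSpace ℝ E]
  {M : Type*} [TopologicalSpace M] [ChartedSpace E M]

variable (E) in
/-- The fibre `End(T_x M)` of the bundle `End(TM)`, with model fibre `E →L[ℝ] E`. -/
abbrev EndT (x : M) : Type _ := TangentSpace 𝓘(ℝ, E) x →L[ℝ] TangentSpace 𝓘(ℝ, E) x

variable (E M) in
/-- The total space of `End(TM)`, a smooth manifold modelled on `E × (E →L[ℝ] E)`. -/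
abbrev EndBundle : Type _ := TotalSpace (E →L[ℝ] E) (EndT E : M → Type _)

variable (E) in
/-- The model with corners of the total space of `End(TM)`. -/
abbrev endModel : ModelWithCorners ℝ (E × (E →L[ℝ] E)) (ModelProd E (E →L[ℝ] E)) :=
  𝓘(ℝ, E).prod 𝓘(ℝ, E →L[ℝ] E)

variable [IsManifold 𝓘(ℝ, E) ∞ M]

/-- A section of `End(TM)`, viewed as a map into the total space. -/
def secMap (A : Π x : M, EndT E x) (x : M) : EndBundle E M := ⟨x, A x⟩

/-- For a differentiable section `A` of `End(TM)`, the expression `D(A Y) - A (D Y)` is tensorial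
in the vector field `Y`. -/
theorem tensorialAt_endCov
    (D : CovariantDerivative 𝓘(ℝ, E) E (TangentSpace 𝓘(ℝ, E) : M → Type _))
    (A : Π x : M, EndT E x) (x : M)
    (hA : MDifferentiableAt 𝓘(ℝ, E) (endModel E) (secMap A) x) :
    TensorialAt 𝓘(ℝ, E) E
      (fun Y : Π x : M, TangentSpace 𝓘(ℝ, E) x ↦ D (fun y ↦ A y (Y y)) x - A x ∘L D Y x) x where
  smul := by
    intro f Y hf hY
    have hAY : MDiffAt (T% (fun y ↦ A y (Y y))) x := hA.clm_bundle_apply hY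
    have h1 : (fun y ↦ A y ((f • Y) y)) = f • (fun y ↦ A y (Y y)) := by
      funext y; simp
    rw [h1, D.isCovariantDerivativeOnUniv.leibniz hAY hf,
      D.isCovariantDerivativeOnUniv.leibniz hY hf]
    ext v
    simp
    module
  add := by
    intro Y Y' hY hY'
    have hAY : MDiffAt (T% (fun y ↦ A y (Y y))) x := hA.clm_bundle_apply hY
    have hAY' : MDiffAt (T% (fun y ↦ A y (Y' y))) x := hA.clm_bundle_apply hY'
    have h1 : (fun y ↦ A y ((Y + Y') y)) = (fun y ↦ A y (Y y)) + (fun y ↦ A y (Y' y)) := by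
      funext y; simp
    rw [h1, D.isCovariantDerivativeOnUniv.add hAY hAY',
      D.isCovariantDerivativeOnUniv.add hY hY']
    ext v
    simp
    abel

variable [FiniteDimensional ℝ E]

open Classical in
/-- The covariant derivative `D_X A` of a section `A` of `End(TM)` with respect to the connection
induced by `D`: `(D_X A) Y = D_X (A Y) - A (D_X Y)` (see `endCov_apply`); it is `0` where `A` is not
differentiable. As for Mathlib's covariant derivatives, `endCov D A x X` stands for `D_X A`. -/
def endCov (D : CovariantDerivative 𝓘(ℝ, E) E (TangentSpace 𝓘(ℝ, E) : M → Type _))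
    (A : Π x : M, EndT E x) (x : M) : TangentSpace 𝓘(ℝ, E) x →L[ℝ] EndT E x :=
  if hA : MDifferentiableAt 𝓘(ℝ, E) (endModel E) (secMap A) x then
    ContinuousLinearMap.flip (E := E) (F := E) (G := E)
      (TensorialAt.mkHom _ x (tensorialAt_endCov D A x hA))
  else 0

/-- The defining property of the induced connection on `End(TM)`. -/
theorem endCov_apply (D : CovariantDerivative 𝓘(ℝ, E) E (TangentSpace 𝓘(ℝ, E) : M → Type _))
    (A : Π x : M, EndT E x) (x : M)
    (hA : MDifferentiableAt 𝓘(ℝ, E) (endModel E) (secMap A) x)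
    (Y : Π x : M, TangentSpace 𝓘(ℝ, E) x) (hY : MDiffAt (T% Y) x)
    (X : TangentSpace 𝓘(ℝ, E) x) :
    endCov D A x X (Y x) = D (fun y ↦ A y (Y y)) x X - A x (D Y x X) := by
  have h : endCov D A x = ContinuousLinearMap.flip (E := E) (F := E) (G := E)
      (TensorialAt.mkHom _ x (tensorialAt_endCov D A x hA)) := dif_pos hA
  rw [h]
  exact congrArg (fun L ↦ L X) (TensorialAt.mkHom_apply (tensorialAt_endCov D A x hA) hY)

/-! ## Quaternionic structures and quaternionic connections -/

/-- `J 0, J 1, J 2` is an admissible basis of the subspace `Qx` of `End(T_x M)`: three complex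
structures that satisfy the quaternionic relations and generate `Qx`. -/
structure IsAdmissibleBasis {x : M} (Qx : Submodule ℝ (EndT E x)) (J : Fin 3 → EndT E x) :
    Prop where
  sq : ∀ i, J i ∘L J i = -ContinuousLinearMap.id ℝ (TangentSpace 𝓘(ℝ, E) x)
  mul_zero_one : J 0 ∘L J 1 = J 2
  mul_one_two : J 1 ∘L J 2 = J 0
  mul_two_zero : J 2 ∘L J 0 = J 1
  span_eq : Submodule.span ℝ (Set.range J) = Qx

/-- `Q` is an almost quaternionic structure: a subbundle of `End(TM)` which is locally generated by
three smooth almost complex structures that satisfy the quaternionic relations. -/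
def IsAlmostQuaternionic (Q : Π x : M, Submodule ℝ (EndT E x)) : Prop :=
  ∀ p : M, ∃ U : Set M, IsOpen U ∧ p ∈ U ∧ ∃ J : Fin 3 → Π x : M, EndT E x,
    (∀ i, ContMDiffOn 𝓘(ℝ, E) (endModel E) ∞ (secMap (J i)) U) ∧
      ∀ x ∈ U, IsAdmissibleBasis (Q x) (fun i ↦ J i x)

/-- `A` restricts to a smooth section of `Q` over `U`. -/
def IsSmoothSectionOn (Q : Π x : M, Submodule ℝ (EndT E x)) (A : Π x : M, EndT E x)
    (U : Set M) : Prop :=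
  ContMDiffOn 𝓘(ℝ, E) (endModel E) ∞ (secMap A) U ∧ ∀ x ∈ U, A x ∈ Q x

/-- `D` is a quaternionic connection on `(M, Q)`: a smooth torsion-free linear connection which
preserves `Q`, that is, which maps (local) sections of `Q` to `Q`-valued `1`-forms. -/
structure IsQuaternionicConnection (Q : Π x : M, Submodule ℝ (EndT E x))
    (D : CovariantDerivative 𝓘(ℝ, E) E (TangentSpace 𝓘(ℝ, E) : M → Type _)) : Prop where
  smooth : D.ContMDiffCovariantDerivative ∞
  torsion_eq_zero : D.torsion = 0
  preserves : ∀ (U : Set M) (A : Π x : M, EndT E x), IsOpen U → IsSmoothSectionOn Q A U →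
    ∀ x ∈ U, ∀ X : TangentSpace 𝓘(ℝ, E) x, endCov D A x X ∈ Q x

/-! ## Self-dual connections -/

variable (E M) in
/-- Vector fields on `M`. -/
abbrev VF : Type _ := Π x : M, TangentSpace 𝓘(ℝ, E) x

/-- Smooth vector fields. -/
def IsSmoothVF (X : VF E M) : Prop :=
  ContMDiff 𝓘(ℝ, E) 𝓘(ℝ, E).tangent ∞ (fun x ↦ (⟨x, X x⟩ : TangentBundle 𝓘(ℝ, E) M))

variable (E M) in
/-- Differential forms of degree `k` on `M`, not assumed to be smooth. -/
abbrev Form (k : ℕ) : Type _ := Π x : M, (TangentSpace 𝓘(ℝ, E) x) [⋀^Fin k]→ₗ[ℝ] ℝ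

/-- The function `η(Y₁, …, Y_k)`, for a `k`-form `η` and vector fields `Y₁, …, Y_k`. -/
def Form.eval {k : ℕ} (η : Form E M k) (Y : Fin k → VF E M) (x : M) : ℝ := η x (fun i ↦ Y i x)

/-- A `k`-form is smooth if it takes smooth values on smooth vector fields. -/
def Form.IsSmooth {k : ℕ} (η : Form E M k) : Prop :=
  ∀ Y : Fin k → VF E M, (∀ i, IsSmoothVF (Y i)) →
    ContMDiff 𝓘(ℝ, E) 𝓘(ℝ, ℝ) ∞ (η.eval Y)

/-- The covariant derivative `D_X` on covariant tensors of degree `k`, the latter being considered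
as functions of `k` vector fields:
`(D_X Φ)(Y₁, …, Y_k) = X (Φ (Y₁, …, Y_k)) - ∑ i, Φ (Y₁, …, D_X Y_i, …, Y_k)`. -/
def tensorCov (D : CovariantDerivative 𝓘(ℝ, E) E (TangentSpace 𝓘(ℝ, E) : M → Type _)) {k : ℕ}
    (X : VF E M) (Φ : (Fin k → VF E M) → M → ℝ) : (Fin k → VF E M) → M → ℝ :=
  fun Y x ↦ mvfderiv 𝓘(ℝ, E) (Φ Y) x (X x)
    - ∑ i, Φ (Function.update Y i (fun y ↦ D (Y i) y (X y))) x

/-- The curvature `R_{X,Y} η = D_X D_Y η - D_Y D_X η - D_{[X,Y]} η` of the connection induced by `D`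
on the bundle of `k`-forms. -/
def formCurvature (D : CovariantDerivative 𝓘(ℝ, E) E (TangentSpace 𝓘(ℝ, E) : M → Type _)) {k : ℕ}
    (X Y : VF E M) (η : Form E M k) (W : Fin k → VF E M) (x : M) : ℝ :=
  tensorCov D X (tensorCov D Y η.eval) W x - tensorCov D Y (tensorCov D X η.eval) W x
    - tensorCov D (VectorField.mlieBracket 𝓘(ℝ, E) X Y) η.eval W x

/-- `D` is self-dual: the curvature of the connection induced by `D` on the bundle `Λ^{top}(T^*M)`
is `Q`-hermitian, i.e. `R_{JX,JY} = R_{X,Y}` for every complex structure `J` which belongs to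
`Q`. -/
def IsSelfDual (Q : Π x : M, Submodule ℝ (EndT E x))
    (D : CovariantDerivative 𝓘(ℝ, E) E (TangentSpace 𝓘(ℝ, E) : M → Type _)) : Prop :=
  ∀ (η : Form E M (Module.finrank ℝ E)), η.IsSmooth →
  ∀ (W : Fin (Module.finrank ℝ E) → VF E M), (∀ i, IsSmoothVF (W i)) →
  ∀ X Y X' Y' : VF E M, IsSmoothVF X → IsSmoothVF Y → IsSmoothVF X' → IsSmoothVF Y' →
  ∀ (p : M), ∀ J ∈ Q p, J ∘L J = -ContinuousLinearMap.id ℝ (TangentSpace 𝓘(ℝ, E) p) →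
    X' p = J (X p) → Y' p = J (Y p) →
    formCurvature D X' Y' η W p = formCurvature D X Y η W p

/-! ## The twistor space -/

/-- The twistor space `Z` of `(M, Q)`, as a subset of the total space of `End(TM)`: the set of
complex structures of the tangent spaces of `M` which belong to `Q`. -/
def twistorSpace (Q : Π x : M, Submodule ℝ (EndT E x)) : Set (EndBundle E M) :=
  {z | z.2 ∈ Q z.proj ∧
    z.2 ∘L z.2 = -ContinuousLinearMap.id ℝ (TangentSpace 𝓘(ℝ, E) z.proj)}

/-- The tangent space `T_z Z` of the twistor space, as a subset of the tangent space at `z` of the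
total space of `End(TM)`: the velocities at `0` of smooth curves in `Z` that start at `z`. -/
def twistorTangent (Q : Π x : M, Submodule ℝ (EndT E x)) (z : EndBundle E M) :
    Set (TangentSpace (endModel E) z) :=
  {U | ∃ c : ℝ → EndBundle E M, ContMDiffAt 𝓘(ℝ, ℝ) (endModel E) ∞ c 0 ∧
    (∀ᶠ t in 𝓝 (0 : ℝ), c t ∈ twistorSpace Q) ∧ c 0 = z ∧
    (mfderiv 𝓘(ℝ, ℝ) (endModel E) c 0 (1 : ℝ) : E × (E →L[ℝ] E)) = U}

/-- The differential `π_* : T_z Z → T_p M` of the bundle projection. -/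
def projDeriv (z : EndBundle E M) (U : TangentSpace (endModel E) z) :
    TangentSpace 𝓘(ℝ, E) z.proj :=
  mfderiv (endModel E) 𝓘(ℝ, E) (TotalSpace.proj : EndBundle E M → M) z U

/-- The pull-back `π^*D` of the connection `D` of `End(TM)` to a subset `S` of the total space
`π : End(TM) → M`, applied to a section `s` of `π^*End(TM)` over `S` and a tangent vector `U` to `S`
at `z ∈ S`. If `(e_i)` is the frame of `End(TM)` near `π z` defined by a local trivialization and
`s = ∑ f_i π^*e_i`, then `(π^*D)_U s = ∑ (U f_i) e_i + ∑ f_i(z) D_{π_* U} e_i`. The first sum is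
computed by differentiating within `S` the expression of `s` in the trivialization, and
`∑ f_i(z) e_i` is the local section `extend _ (s z)`. -/
def pullbackCov (D : CovariantDerivative 𝓘(ℝ, E) E (TangentSpace 𝓘(ℝ, E) : M → Type _))
    (S : Set (EndBundle E M)) (s : Π z : EndBundle E M, EndT E z.proj) (z : EndBundle E M)
    (U : TangentSpace (endModel E) z) : EndT E z.proj :=
  (trivializationAt (E →L[ℝ] E) (EndT E : M → Type _) z.proj).symmL ℝ z.proj
      (mvfderivWithin (endModel E)
        (fun w ↦ (trivializationAt (E →L[ℝ] E) (EndT E : M → Type _) z.proj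
          (⟨w.proj, s w⟩ : EndBundle E M)).2) S z U)
    + endCov D (extend (E →L[ℝ] E) (s z)) z.proj (projDeriv z U)

/-- The vertical part of a tangent vector `U` of the total space of `End(TM)`, with respect to the
horizontal distribution of `D`. It is `(π^*D)_U τ`, where `τ(z) = z` is the tautological section
of `π^*End(TM)`. -/
def verticalPart (D : CovariantDerivative 𝓘(ℝ, E) E (TangentSpace 𝓘(ℝ, E) : M → Type _))
    (z : EndBundle E M) (U : TangentSpace (endModel E) z) : EndT E z.proj :=
  pullbackCov D Set.univ (fun w ↦ w.2) z U

/-- The vertical tangent vector at `z` which is defined by an element `B` of the vector space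
`End(T_p M)`, the velocity of the curve `z + t B`. -/
def verticalLift (z : EndBundle E M) (B : EndT E z.proj) : TangentSpace (endModel E) z :=
  (mfderiv 𝓘(ℝ, ℝ) (endModel E) (fun t : ℝ ↦ (⟨z.proj, z.2 + t • B⟩ : EndBundle E M)) 0 (1 : ℝ) :
    E × (E →L[ℝ] E))

/-- The image `σ_* X` of `X ∈ T_p M` under the differential of the local section
`σ = extend _ z` of `End(TM)`, which satisfies `σ(p) = z`. -/
def sectionLift (z : EndBundle E M) (X : TangentSpace 𝓘(ℝ, E) z.proj) :
    TangentSpace (endModel E) z :=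
  (mfderiv 𝓘(ℝ, E) (endModel E) (secMap (extend (E →L[ℝ] E) z.2)) z.proj X : E × (E →L[ℝ] E))

/-- The horizontal lift of `X` at `z` with respect to `D`: it is `σ_* X - D_X σ` (the second term
being considered as a vertical vector), for a local section `σ` with `σ(p) = z`. -/
def horizontalLift (D : CovariantDerivative 𝓘(ℝ, E) E (TangentSpace 𝓘(ℝ, E) : M → Type _))
    (z : EndBundle E M) (X : TangentSpace 𝓘(ℝ, E) z.proj) : TangentSpace (endModel E) z :=
  sectionLift z X - verticalLift z (endCov D (extend (E →L[ℝ] E) z.2) z.proj X)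

/-- The almost complex structure `𝒥` of the twistor space: at `z = J ∈ Z` it is `J` on the
horizontal space (identified with `T_p M` by `π_*`), and `B ↦ J ∘ B` on the vertical space. -/
def twistorJ (D : CovariantDerivative 𝓘(ℝ, E) E (TangentSpace 𝓘(ℝ, E) : M → Type _))
    (z : EndBundle E M) (U : TangentSpace (endModel E) z) : TangentSpace (endModel E) z :=
  horizontalLift D z (z.2 (projDeriv z U)) + verticalLift z (z.2 ∘L verticalPart D z U)

/-! ## The vertical tangent bundle `Θ` and its sections -/

/-- The fibre `Θ_J` of the vertical tangent bundle at `z = J ∈ Z`: the `J`-anti-linear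
endomorphisms which belong to `Q`. Its complex structure is `B ↦ J ∘ B`. -/
def theta (Q : Π x : M, Submodule ℝ (EndT E x)) (z : EndBundle E M) : Set (EndT E z.proj) :=
  {B | B ∈ Q z.proj ∧ B ∘L z.2 = -(z.2 ∘L B)}

/-- The projection `Π_J B = (B + J ∘ B ∘ J) / 2` of `Q_p` onto `Θ_J`, for `z = J`. -/
def thetaProj (z : EndBundle E M) (B : EndT E z.proj) : EndT E z.proj :=
  (2⁻¹ : ℝ) • (B + z.2 ∘L B ∘L z.2)

/-- The distinguished section `Ã` of `Θ` which is defined by a section `A` of `Q`: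
`Ã(J) = Π_J (A)`. -/
def distinguishedSection (A : Π x : M, EndT E x) (z : EndBundle E M) : EndT E z.proj :=
  thetaProj z (A z.proj)

/-- The connection `∇ = Π ∘ π^*D` of `Θ`. -/
def thetaCov (Q : Π x : M, Submodule ℝ (EndT E x))
    (D : CovariantDerivative 𝓘(ℝ, E) E (TangentSpace 𝓘(ℝ, E) : M → Type _))
    (s : Π z : EndBundle E M, EndT E z.proj) (z : EndBundle E M)
    (U : TangentSpace (endModel E) z) : EndT E z.proj :=
  thetaProj z (pullbackCov D (twistorSpace Q) s z U)

/-- The operator `∂̄^D`, the `(0,1)`-part of `∇`: `∂̄_U s = (∇_U s + 𝒥 ∇_{𝒥 U} s) / 2`. -/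
def dbar (Q : Π x : M, Submodule ℝ (EndT E x))
    (D : CovariantDerivative 𝓘(ℝ, E) E (TangentSpace 𝓘(ℝ, E) : M → Type _))
    (s : Π z : EndBundle E M, EndT E z.proj) (z : EndBundle E M)
    (U : TangentSpace (endModel E) z) : EndT E z.proj :=
  (2⁻¹ : ℝ) • (thetaCov Q D s z U + z.2 ∘L thetaCov Q D s z (twistorJ D z U))

/-- `s` is a `∂̄^D`-holomorphic section of `Θ → Z`: a smooth section with `∂̄^D s = 0`. Only the
values of `s` on `Z` matter. -/
structure IsHolomorphicSection (Q : Π x : M, Submodule ℝ (EndT E x))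
    (D : CovariantDerivative 𝓘(ℝ, E) E (TangentSpace 𝓘(ℝ, E) : M → Type _))
    (s : Π z : EndBundle E M, EndT E z.proj) : Prop where
  mem_theta : ∀ z ∈ twistorSpace Q, s z ∈ theta Q z
  smooth : ContMDiffOn (endModel E) (endModel E) ∞
    (fun z ↦ (⟨z.proj, s z⟩ : EndBundle E M)) (twistorSpace Q)
  dbar_eq_zero : ∀ z ∈ twistorSpace Q, ∀ U ∈ twistorTangent Q z, dbar Q D s z U = 0

end Geometry

/-! ## Representations of `Sp(1)` -/

section Representations

/-- The standard representation `H = ℂ²` of `Sp(1) = SU(2)`, with its hermitian metric. -/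
abbrev Hrep : Type := EuclideanSpace ℂ (Fin 2)

/-- The hermitian metric of `H ⊗ (H ⊗ H)` induced by the one of `H`. -/
instance : NormedAddCommGroup (Hrep ⊗[ℂ] (Hrep ⊗[ℂ] Hrep)) :=
  TensorProduct.instNormedAddCommGroup

instance : InnerProductSpace ℂ (Hrep ⊗[ℂ] (Hrep ⊗[ℂ] Hrep)) :=
  TensorProduct.instInnerProductSpace

/-- The unitary basis `h, h̃ = q(h)` of `H`, where `q(v₀, v₁) = (- conj v₁, conj v₀)`. -/
def hb (i : Fin 2) : Hrep := EuclideanSpace.single i 1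

/-- The complex symplectic form `ω` of `H`, with `ω(h, h̃) = 1`; the hermitian metric is
`ω(v, q w)`. -/
def symp : Hrep →ₗ[ℂ] Hrep →ₗ[ℂ] ℂ :=
  LinearMap.mk₂ ℂ (fun v w ↦ v 0 * w 1 - v 1 * w 0)
    (by intros; simp; ring) (by intros; simp; ring) (by intros; simp; ring) (by intros; simp; ring)

/-- The symmetric square `S²(H) ⊂ H ⊗ H`. -/
def S2 : Submodule ℂ (Hrep ⊗[ℂ] Hrep) :=
  LinearMap.eqLocus (TensorProduct.comm ℂ Hrep Hrep).toLinearMap LinearMap.id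

/-- The action of `H ⊗ H ≅ H^* ⊗ H = End(H)` on `H`: `(h₁ ⊗ h₂) · v = ω(h₁, v) h₂`. -/
def act : Hrep ⊗[ℂ] Hrep →ₗ[ℂ] Hrep →ₗ[ℂ] Hrep :=
  TensorProduct.lift
    (LinearMap.mk₂ ℂ (fun h₁ h₂ ↦ (symp h₁).smulRight h₂)
      (by intros; ext; simp [add_mul]) (by intros; ext; simp [mul_assoc])
      (by intros; ext; simp) (by intros; ext; simp [mul_left_comm]))

/-- The standard basis `j₁, j₂, j₃` of the imaginary quaternions `sp(1)`, the real part of `S²(H)`: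
`j₁ = -i (h h̃ + h̃ h)`, `j₂ = -(h h + h̃ h̃)`, `j₃ = i (h̃ h̃ - h h)`. -/
def sp1 : Fin 3 → Hrep ⊗[ℂ] Hrep :=
  ![(-Complex.I) • (hb 0 ⊗ₜ hb 1 + hb 1 ⊗ₜ hb 0),
    -(hb 0 ⊗ₜ hb 0 + hb 1 ⊗ₜ hb 1),
    Complex.I • (hb 1 ⊗ₜ hb 1 - hb 0 ⊗ₜ hb 0)]

/-- The map `F : H ⊗ S²(H) → H`, `F(h, h₁ h₂ + h₂ h₁) = ω(h, h₁) h₂ + ω(h, h₂) h₁`. It is extended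
to `H ⊗ (H ⊗ H)` by `h ⊗ (h₁ ⊗ h₂) ↦ ω(h, h₁) h₂`. -/
def contractF : Hrep ⊗[ℂ] (Hrep ⊗[ℂ] Hrep) →ₗ[ℂ] Hrep :=
  TensorProduct.lift (-act.flip)

/-- The irreducible component `S³(H) = ker F` of `H ⊗ S²(H) ⊂ H ⊗ (H ⊗ H)`. -/
def S3 : Submodule ℂ (Hrep ⊗[ℂ] (Hrep ⊗[ℂ] Hrep)) :=
  LinearMap.range (S2.subtype.lTensor Hrep) ⊓ LinearMap.ker contractF

/-- The isomorphism `Hom(H, H ⊗ H) = H^* ⊗ (H ⊗ H) ≅ H ⊗ (H ⊗ H)` given by the identification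
`H ≅ H^*`, `h ↦ ω(h, ·)`: it is the inverse of `a ⊗ s ↦ (v ↦ ω(a, v) s)`. -/
def raise : (Hrep →ₗ[ℂ] Hrep ⊗[ℂ] Hrep) →ₗ[ℂ] Hrep ⊗[ℂ] (Hrep ⊗[ℂ] Hrep) where
  toFun L := hb 0 ⊗ₜ L (hb 1) - hb 1 ⊗ₜ L (hb 0)
  map_add' L L' := by simp only [LinearMap.add_apply, TensorProduct.tmul_add]; abel
  map_smul' c L := by
    simp only [LinearMap.smul_apply, TensorProduct.tmul_smul, smul_sub, RingHom.id_apply]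

end Representations

/-! ## The Penrose operator -/

section Penrose

variable {E : Type*} [NormedAddCommGroup E] [NormedSpace ℝ E]
  {M : Type*} [TopologicalSpace M] [ChartedSpace E M]

/-- The natural Euclidean metric `⟨A, B⟩ = -tr(A ∘ B) / dim M` of `Q`; admissible bases are
orthonormal. -/
def metricQ {x : M} (A B : EndT E x) : ℝ :=
  -(LinearMap.trace ℝ (TangentSpace 𝓘(ℝ, E) x) (A ∘L B).toLinearMap) / Module.finrank ℝ E

/-- The linear map which is defined on `Q_x` by an admissible basis `J` of `Q_x`, and which
identifies `Q_x` with the real part `sp(1)` of `S²(H)`: `∑ a_i J_i ↦ ∑ a_i j_i`, where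
`a_i = ⟨B, J_i⟩` are the coordinates of `B ∈ Q_x`. -/
def toS2 {x : M} (J : Fin 3 → EndT E x) : EndT E x →ₗ[ℝ] Hrep ⊗[ℂ] Hrep where
  toFun B := ∑ i, metricQ B (J i) • sp1 i
  map_add' B B' := by
    rw [← Finset.sum_add_distrib]
    refine Finset.sum_congr rfl fun i _ ↦ ?_
    rw [← add_smul]
    congr 1
    simp [metricQ, ContinuousLinearMap.add_comp]
    ring
  map_smul' c B := by
    rw [RingHom.id_apply, Finset.smul_sum]
    refine Finset.sum_congr rfl fun i _ ↦ ?_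
    rw [smul_smul]
    congr 1
    simp [metricQ, ContinuousLinearMap.smul_comp]
    ring

/-- The fibre of the (locally defined) bundle `𝐄` at `x`, relative to an admissible basis `J` of
`Q_x`: the space of those `ℂ`-linear maps `e : H → T_x M ⊗ ℂ` which intertwine `j_i` with `J_i`.
The map `e ⊗ h ↦ e(h)` is the isomorphism `𝐄 ⊗ 𝐇 ≅ TM ⊗ ℂ`, for which `J_i` acts as `Id ⊗ j_i`. -/
def Efibre {x : M} (J : Fin 3 → EndT E x) :
    Submodule ℂ (Hrep →ₗ[ℂ] ℂ ⊗[ℝ] TangentSpace 𝓘(ℝ, E) x) where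
  carrier := {e | ∀ (i : Fin 3) (h : Hrep),
    e (act (sp1 i) h) = (J i).toLinearMap.baseChange ℂ (e h)}
  add_mem' {e e'} he he' i h := by
    simp only [LinearMap.add_apply, map_add, he i h, he' i h]
  zero_mem' i h := by simp
  smul_mem' c e he i h := by
    simp only [LinearMap.smul_apply, map_smul, he i h]

/-- The projection `T^*M ⊗ Q → 𝐄^* ⊗ S³(𝐇) = Hom(𝐄, S³(𝐇))` at `x`, relative to an admissible basis
`J` of `Q_x`. Any `γ ∈ T_x^*M ⊗ Q_x` extends by complex linearity to `T_x M ⊗ ℂ = 𝐄 ⊗ 𝐇`, and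
defines, for `e ∈ 𝐄`, an element `h ↦ γ(e(h))` of `Hom(H, S²(H)) ≅ H ⊗ S²(H)`; the latter is
projected onto `S³(H)`, along the hermitian orthogonal of `S³(H)`. -/
def penroseProj {x : M} (J : Fin 3 → EndT E x)
    (γ : TangentSpace 𝓘(ℝ, E) x →L[ℝ] EndT E x) : Efibre J →ₗ[ℂ] S3 :=
  S3.orthogonalProjectionOnto.toLinearMap ∘ₗ raise ∘ₗ
    LinearMap.llcomp ℂ Hrep (ℂ ⊗[ℝ] TangentSpace 𝓘(ℝ, E) x) (Hrep ⊗[ℂ] Hrep)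
      ((toS2 J ∘ₗ γ.toLinearMap).liftBaseChange ℂ) ∘ₗ (Efibre J).subtype

variable [IsManifold 𝓘(ℝ, E) ∞ M] [FiniteDimensional ℝ E]

/-- The Penrose operator `P^D A`, the projection of `DA` to `𝐄^* ⊗ S³(𝐇)`, at `x` and relative to an
admissible basis `J` of `Q_x`. -/
def penroseOperator (D : CovariantDerivative 𝓘(ℝ, E) E (TangentSpace 𝓘(ℝ, E) : M → Type _))
    (A : Π x : M, EndT E x) (x : M) (J : Fin 3 → EndT E x) : Efibre J →ₗ[ℂ] S3 :=
  penroseProj J (endCov D A x)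

/-- `A` is a solution of the Penrose operator: `P^D A = 0`. -/
def IsPenroseSolution (Q : Π x : M, Submodule ℝ (EndT E x))
    (D : CovariantDerivative 𝓘(ℝ, E) E (TangentSpace 𝓘(ℝ, E) : M → Type _))
    (A : Π x : M, EndT E x) : Prop :=
  ∀ (x : M) (J : Fin 3 → EndT E x), IsAdmissibleBasis (Q x) J → penroseOperator D A x J = 0

end Penrose

end QuatTwistor

end

open QuatTwistor

/-!
Write `B` for the vertical part of `U ∈ T_z Z` and `X = π_* U`. Differentiating
`Ã(z) = (A + z A z) / 2` along `Z` gives `Π_z (D_X A)` plus the terms `(z A B + B A z) / 2`. In the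
`(0,1)`-part the latter contribute `Π_z ((z A - A z) B)` up to a factor, which vanishes because both
`z A - A z` and `B` anticommute with `z`. As every `X` has a horizontal lift tangent to `Z`, the
section `Ã` is holomorphic if and only if `γ = DA` satisfies `Π_z (γ(X)) + z Π_z (γ(z X)) = 0` for
all `z` and `X`. Expanding in an admissible basis `J`, this says that `⟨γ(J_i X), J_i⟩` is
independent of `i`. On the other side, `P^D A = 0` says that `γ` is in the second summand
`𝐄^* ⊗ 𝐇` of `𝐄^* ⊗ 𝐇 ⊗ S²(𝐇)`, which is given by the same three-term condition.
-/

noncomputable section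

namespace QuatTwistor

section Representations

lemma hb_apply (i j : Fin 2) : hb i j = if j = i then 1 else 0 := by
  simp [hb]

lemma inner_hb_right (v : Hrep) (i : Fin 2) : inner ℂ v (hb i) = (starRingEnd ℂ) (v i) := by
  simp [hb, EuclideanSpace.inner_single_right]

lemma symp_apply (v w : Hrep) : symp v w = v 0 * w 1 - v 1 * w 0 := rfl

lemma symp_self (v : Hrep) : symp v v = 0 := by
  rw [symp_apply, mul_comm, sub_self]

lemma act_tmul (a b v : Hrep) : act (a ⊗ₜ b) v = symp a v • b := rfl

lemma act_sp1_zero (v : Hrep) :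
    act (sp1 0) v = (Complex.I * v 0) • hb 0 - (Complex.I * v 1) • hb 1 := by
  ext k
  fin_cases k <;> simp [sp1, act_tmul, symp_apply, hb]

lemma act_sp1_one (v : Hrep) : act (sp1 1) v = v 0 • hb 1 - v 1 • hb 0 := by
  ext k
  fin_cases k <;> simp [sp1, act_tmul, symp_apply, hb]

lemma act_sp1_two (v : Hrep) :
    act (sp1 2) v = -((Complex.I * v 0) • hb 1 + (Complex.I * v 1) • hb 0) := by
  ext k
  fin_cases k <;> simp [sp1, act_tmul, symp_apply, hb]

lemma contractF_tmul (h : Hrep) (t : Hrep ⊗[ℂ] Hrep) : contractF (h ⊗ₜ t) = -act t h := rfl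

lemma inner_contractF_hb (s : Hrep ⊗[ℂ] (Hrep ⊗[ℂ] Hrep)) (k : Fin 2) :
    inner ℂ (contractF s) (hb k) = inner ℂ s (hb 0 ⊗ₜ[ℂ] (hb 1 ⊗ₜ[ℂ] hb k)) -
      inner ℂ s (hb 1 ⊗ₜ[ℂ] (hb 0 ⊗ₜ[ℂ] hb k)) := by
  induction s using TensorProduct.induction_on with
  | zero => simp
  | add x y hx hy => rw [map_add]; simp only [inner_add_left, hx, hy]; ring
  | tmul h t =>
    induction t using TensorProduct.induction_on with
    | zero => simp
    | add x y hx hy =>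
      rw [TensorProduct.tmul_add, map_add]; simp only [inner_add_left, hx, hy]; ring
    | tmul a b =>
      rw [contractF_tmul, act_tmul]
      simp only [TensorProduct.inner_tmul, inner_neg_left, inner_smul_left, inner_hb_right,
        symp_apply, map_sub, map_mul]
      ring

lemma tmul_tmul_self_mem_S3 (v : Hrep) : v ⊗ₜ[ℂ] (v ⊗ₜ[ℂ] v) ∈ S3 := by
  refine ⟨⟨v ⊗ₜ ⟨v ⊗ₜ[ℂ] v, rfl⟩, rfl⟩, ?_⟩
  change -(symp v v • v) = 0
  rw [symp_self, zero_smul, neg_zero]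

variable {s : Hrep ⊗[ℂ] (Hrep ⊗[ℂ] Hrep)}

lemma inner_S3_swap_right (hs : s ∈ S3) (a b c : Hrep) :
    inner ℂ s (a ⊗ₜ[ℂ] (b ⊗ₜ[ℂ] c)) = inner ℂ s (a ⊗ₜ[ℂ] (c ⊗ₜ[ℂ] b)) := by
  obtain ⟨t, rfl⟩ := hs.1
  clear hs
  induction t using TensorProduct.induction_on with
  | zero => simp
  | add x y hx hy => rw [map_add, inner_add_left, inner_add_left, hx, hy]
  | tmul h q =>
    have hq : TensorProduct.comm ℂ Hrep Hrep (q : Hrep ⊗[ℂ] Hrep) = q := q.2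
    have := TensorProduct.inner_comm_comm (𝕜 := ℂ) (q : Hrep ⊗[ℂ] Hrep) (b ⊗ₜ[ℂ] c)
    rw [hq] at this
    rw [LinearMap.lTensor_tmul, TensorProduct.inner_tmul, TensorProduct.inner_tmul]
    exact congrArg _ this.symm

lemma inner_S3_swap_left (hs : s ∈ S3) (k : Fin 2) :
    inner ℂ s (hb 0 ⊗ₜ[ℂ] (hb 1 ⊗ₜ[ℂ] hb k)) = inner ℂ s (hb 1 ⊗ₜ[ℂ] (hb 0 ⊗ₜ[ℂ] hb k)) := by
  rw [← sub_eq_zero, ← inner_contractF_hb, show contractF s = 0 from hs.2, inner_zero_left]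

lemma inner_S3_raise (hs : s ∈ S3) (x : Fin 3 → Hrep →ₗ[ℂ] ℂ) :
    inner ℂ s (raise (∑ i, (x i).smulRight (sp1 i))) =
      -(x 1 (hb 1) + Complex.I * x 2 (hb 1)) * inner ℂ s (hb 0 ⊗ₜ[ℂ] (hb 0 ⊗ₜ[ℂ] hb 0)) +
      (x 1 (hb 0) + Complex.I * x 2 (hb 0) - 2 * Complex.I * x 0 (hb 1)) *
        inner ℂ s (hb 0 ⊗ₜ[ℂ] (hb 0 ⊗ₜ[ℂ] hb 1)) +
      (2 * Complex.I * x 0 (hb 0) + Complex.I * x 2 (hb 1) - x 1 (hb 1)) *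
        inner ℂ s (hb 0 ⊗ₜ[ℂ] (hb 1 ⊗ₜ[ℂ] hb 1)) +
      (x 1 (hb 0) - Complex.I * x 2 (hb 0)) * inner ℂ s (hb 1 ⊗ₜ[ℂ] (hb 1 ⊗ₜ[ℂ] hb 1)) := by
  simp only [raise, LinearMap.coe_mk, AddHom.coe_mk, Fin.sum_univ_three, LinearMap.add_apply,
    LinearMap.smulRight_apply, sp1, Matrix.cons_val_zero, Matrix.cons_val_one, Matrix.cons_val,
    TensorProduct.tmul_add, TensorProduct.tmul_sub, TensorProduct.tmul_smul,
    TensorProduct.tmul_neg, inner_sub_right, inner_add_right, inner_smul_right, inner_neg_right]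
  rw [inner_S3_swap_right hs (hb 1) (hb 1) (hb 0), ← inner_S3_swap_left hs 0,
    ← inner_S3_swap_left hs 1, inner_S3_swap_right hs (hb 0) (hb 1) (hb 0)]
  ring

lemma forall_apply_act_sp1_eq_iff (x : Fin 3 → Hrep →ₗ[ℂ] ℂ) :
    (∀ i j v, x i (act (sp1 i) v) = x j (act (sp1 j) v)) ↔
      x 1 (hb 0) = Complex.I * x 0 (hb 1) ∧ x 1 (hb 1) = Complex.I * x 0 (hb 0) ∧
      x 2 (hb 0) = x 0 (hb 1) ∧ x 2 (hb 1) = -x 0 (hb 0) := by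
  constructor
  · intro h
    have h₁₀ := h 1 0 (hb 0)
    have h₂₀ := h 2 0 (hb 0)
    have h₁₁ := h 1 0 (hb 1)
    have h₂₁ := h 2 0 (hb 1)
    simp only [act_sp1_zero, act_sp1_one, act_sp1_two, hb_apply, map_sub, map_add, map_neg,
      map_smul, smul_eq_mul, if_true, if_false, zero_ne_one, one_ne_zero] at h₁₀ h₂₀ h₁₁ h₂₁
    refine ⟨?_, ?_, ?_, ?_⟩
    · linear_combination -h₁₁
    · linear_combination h₁₀
    · linear_combination Complex.I * h₂₁ + (x 2 (hb 0) - x 0 (hb 1)) * Complex.I_mul_I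
    · linear_combination Complex.I * h₂₀ + (x 2 (hb 1) + x 0 (hb 0)) * Complex.I_mul_I
  · rintro ⟨h₁₀, h₁₁, h₂₀, h₂₁⟩
    suffices ∀ i v, x i (act (sp1 i) v) = x 0 (act (sp1 0) v) from
      fun i j v ↦ (this i v).trans (this j v).symm
    intro i v
    fin_cases i <;>
      simp only [Fin.zero_eta, Fin.mk_one, Fin.reduceFinMk, act_sp1_zero, act_sp1_one, act_sp1_two,
        map_sub, map_add, map_neg, map_smul, smul_eq_mul, h₁₀, h₁₁, h₂₀, h₂₁] <;>
      ring

/-- The orthogonal of `S³(H)` in `H ⊗ S²(H)` is the copy of `H^*` formed by the maps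
`v ↦ ∑ λ(j_i v) j_i`, `λ ∈ H^*`. It suffices to test orthogonality on the cubes
`(a h + b h̃)³`. -/
lemma raise_mem_S3_orthogonal_iff (x : Fin 3 → Hrep →ₗ[ℂ] ℂ) :
    raise (∑ i, (x i).smulRight (sp1 i)) ∈ S3ᗮ ↔
      ∀ i j v, x i (act (sp1 i) v) = x j (act (sp1 j) v) := by
  rw [Submodule.mem_orthogonal, forall_apply_act_sp1_eq_iff]
  constructor
  · intro h
    have hcube (a b : ℤ) :=
      (inner_S3_raise (tmul_tmul_self_mem_S3 ((a : ℂ) • hb 0 + (b : ℂ) • hb 1)) x).symm.trans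
        (h _ (tmul_tmul_self_mem_S3 _))
    simp only [TensorProduct.inner_tmul, inner_hb_right, PiLp.add_apply, PiLp.smul_apply, hb_apply,
      smul_eq_mul, mul_one, mul_zero, add_zero, zero_add, if_true, if_false, zero_ne_one,
      one_ne_zero, map_intCast] at hcube
    have h₁₀ := hcube 1 0
    have h₀₁ := hcube 0 1
    have h₁₁ := hcube 1 1
    have h₁₂ := hcube 1 (-1)
    push_cast at h₁₀ h₀₁ h₁₁ h₁₂
    refine ⟨?_, ?_, ?_, ?_⟩
    · linear_combination (h₁₁ - h₁₂) / 4
    · linear_combination -(h₁₁ + h₁₂) / 4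
    · linear_combination (-Complex.I / 2) * ((h₁₁ - h₁₂) / 2 - 2 * h₀₁) +
        (x 2 (hb 0) - x 0 (hb 1)) * Complex.I_mul_I
    · linear_combination (-Complex.I / 2) * ((h₁₁ + h₁₂) / 2 - 2 * h₁₀) +
        (x 2 (hb 1) + x 0 (hb 0)) * Complex.I_mul_I
  · rintro ⟨h₁₀, h₁₁, h₂₀, h₂₁⟩ s hs
    rw [inner_S3_raise hs, h₁₀, h₁₁, h₂₀, h₂₁]
    ring

end Representations

section QuaternionicTriples

open scoped Matrix

variable {R : Type*} [Ring R]

/-- Three elements of a ring that satisfy the relations of the imaginary quaternions `i, j, k`. -/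
structure IsQuaternionicTriple (I : Fin 3 → R) : Prop where
  sq (i : Fin 3) : I i * I i = -1
  mul_zero_one : I 0 * I 1 = I 2
  mul_one_two : I 1 * I 2 = I 0
  mul_two_zero : I 2 * I 0 = I 1

namespace IsQuaternionicTriple

variable {I : Fin 3 → R} (h : IsQuaternionicTriple I)
include h

lemma mul_one_zero : I 1 * I 0 = -I 2 := by
  rw [← h.mul_one_two, ← mul_assoc, h.sq, neg_one_mul]

lemma mul_two_one : I 2 * I 1 = -I 0 := by
  rw [← h.mul_two_zero, ← mul_assoc, h.sq, neg_one_mul]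

lemma mul_zero_two : I 0 * I 2 = -I 1 := by
  rw [← h.mul_zero_one, ← mul_assoc, h.sq, neg_one_mul]

lemma mul_succ (i : Fin 3) : I i * I (i + 1) = I (i + 2) := by
  fin_cases i
  exacts [h.mul_zero_one, h.mul_one_two, h.mul_two_zero]

lemma succ_mul (i : Fin 3) : I (i + 1) * I i = -I (i + 2) := by
  fin_cases i
  exacts [h.mul_one_zero, h.mul_two_one, h.mul_zero_two]

lemma mul_eq_neg_mul {i j : Fin 3} (hij : i ≠ j) : I j * I i = -(I i * I j) := by
  obtain rfl | rfl : j = i + 1 ∨ i = j + 1 := by grind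
  · rw [h.succ_mul, h.mul_succ]
  · rw [h.succ_mul, h.mul_succ, neg_neg]

variable [Algebra ℝ R]

lemma sum_smul_mul_sum_smul (u w : Fin 3 → ℝ) :
    (∑ i, u i • I i) * (∑ i, w i • I i) = -(u ⬝ᵥ w) • (1 : R) + ∑ i, (u ⨯₃ w) i • I i := by
  simp only [Fin.sum_univ_three, add_mul, mul_add, smul_mul_smul_comm, h.sq, h.mul_zero_one,
    h.mul_one_two, h.mul_two_zero, h.mul_one_zero, h.mul_two_one, h.mul_zero_two, cross_apply,
    dotProduct, Matrix.cons_val_zero, Matrix.cons_val_one, Matrix.cons_val]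
  module

lemma sum_smul_mul_self (u : Fin 3 → ℝ) :
    (∑ i, u i • I i) * (∑ i, u i • I i) = -(u ⬝ᵥ u) • (1 : R) := by
  simp [h.sum_smul_mul_sum_smul]

lemma sum_smul_mul_add_mul_sum_smul (u w : Fin 3 → ℝ) :
    (∑ i, w i • I i) * (∑ i, u i • I i) + (∑ i, u i • I i) * (∑ i, w i • I i) =
      (-2 * u ⬝ᵥ w) • (1 : R) := by
  rw [h.sum_smul_mul_sum_smul, h.sum_smul_mul_sum_smul, ← cross_anticomm u w, dotProduct_comm w u]
  simp only [Pi.neg_apply, neg_smul, Finset.sum_neg_distrib]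
  module

lemma dotProduct_self_eq_one [Nontrivial R] {u : Fin 3 → ℝ}
    (hu : (∑ i, u i • I i) * (∑ i, u i • I i) = -1) : u ⬝ᵥ u = 1 := by
  rw [h.sum_smul_mul_self, neg_smul, neg_inj, ← sub_eq_zero] at hu
  have : (u ⬝ᵥ u - 1) • (1 : R) = 0 := by rw [sub_smul, one_smul, hu]
  exact sub_eq_zero.1 ((smul_eq_zero_iff_left one_ne_zero).1 this)

lemma dotProduct_eq_zero [Nontrivial R] {u w : Fin 3 → ℝ}
    (huw : (∑ i, w i • I i) * (∑ i, u i • I i) = -((∑ i, u i • I i) * (∑ i, w i • I i))) :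
    u ⬝ᵥ w = 0 := by
  rw [eq_neg_iff_add_eq_zero, h.sum_smul_mul_add_mul_sum_smul,
    smul_eq_zero_iff_left one_ne_zero] at huw
  linarith

lemma mul_mem_span [Nontrivial R] {z B : R} (hz : z ∈ Submodule.span ℝ (range I))
    (hB : B ∈ Submodule.span ℝ (range I)) (hzB : B * z = -(z * B)) :
    z * B ∈ Submodule.span ℝ (range I) := by
  rw [Submodule.mem_span_range_iff_exists_fun] at hz hB ⊢
  obtain ⟨u, rfl⟩ := hz
  obtain ⟨w, rfl⟩ := hB
  refine ⟨u ⨯₃ w, ?_⟩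
  rw [h.sum_smul_mul_sum_smul, h.dotProduct_eq_zero hzB, neg_zero, zero_smul, zero_add]

lemma mul_mul_mem_span {z A : R} (hz : z ∈ Submodule.span ℝ (range I))
    (hA : A ∈ Submodule.span ℝ (range I)) : z * (A * z) ∈ Submodule.span ℝ (range I) := by
  obtain ⟨u, hu⟩ := (Submodule.mem_span_range_iff_exists_fun ℝ).1 hz
  obtain ⟨w, hw⟩ := (Submodule.mem_span_range_iff_exists_fun ℝ).1 hA
  have hAz : A * z = (-2 * u ⬝ᵥ w) • (1 : R) - z * A := by
    rw [eq_sub_iff_add_eq, ← hu, ← hw, h.sum_smul_mul_add_mul_sum_smul]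
  have hzz : z * z = -(u ⬝ᵥ u) • (1 : R) := by rw [← hu, h.sum_smul_mul_self]
  rw [hAz, mul_sub, mul_smul_comm, mul_one, ← mul_assoc, hzz, smul_one_mul]
  exact sub_mem (Submodule.smul_mem _ _ hz) (Submodule.smul_mem _ _ hA)

lemma apply_mul_sum_smul (φ : R →ₗ[ℝ] ℝ) (u : Fin 3 → ℝ) :
    (fun i ↦ φ (I i * ∑ j, u j • I j)) = -φ 1 • u + u ⨯₃ fun i ↦ φ (I i) := by
  ext i
  fin_cases i <;>
  · simp only [Fin.zero_eta, Fin.mk_one, Fin.reduceFinMk, Fin.sum_univ_three, mul_add,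
      mul_smul_comm, h.sq, h.mul_zero_one, h.mul_one_two, h.mul_two_zero, h.mul_one_zero,
      h.mul_two_one, h.mul_zero_two, smul_neg, map_add, map_neg, map_smul, smul_eq_mul, neg_smul,
      cross_apply, Pi.add_apply, Pi.neg_apply, Pi.smul_apply, Matrix.cons_val]
    ring

/-- The tensor `∑ I i ⊗ I i` is invariant under the unit quaternions; contracting one factor with
`φ` gives, up to terms that commute with `z`, the type `(1, 0)` part. -/
lemma commute_sum_smul_add_mul [Nontrivial R] (φ : R →ₗ[ℝ] ℝ) {u : Fin 3 → ℝ} {z : R}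
    (hz : z = ∑ i, u i • I i) (hzz : z * z = -1) :
    Commute z ((∑ i, φ (I i) • I i) + z * ∑ i, φ (I i * z) • I i) := by
  have hu : u ⬝ᵥ u = 1 := h.dotProduct_self_eq_one (hz ▸ hzz)
  set c : Fin 3 → ℝ := fun i ↦ φ (I i)
  have hK : (∑ i, φ (I i) • I i) + z * ∑ i, φ (I i * z) • I i =
      φ 1 • (1 : R) + (u ⬝ᵥ c) • z := by
    have hcz : (fun i ↦ φ (I i * z)) = -φ 1 • u + u ⨯₃ c := hz ▸ h.apply_mul_sum_smul φ u
    have hdot : u ⬝ᵥ (-φ 1 • u + u ⨯₃ c) = -φ 1 := by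
      rw [dotProduct_add, dotProduct_smul, hu, dot_self_cross, smul_eq_mul, mul_one, add_zero]
    have hcross : u ⨯₃ (-φ 1 • u + u ⨯₃ c) = (u ⬝ᵥ c) • u - c := by
      rw [map_add, map_smul, cross_self, cross_cross_eq_smul_sub_smul', hu, smul_zero, zero_add,
        one_smul]
    have hsum : z * ∑ i, (fun i ↦ φ (I i * z)) i • I i =
        φ 1 • (1 : R) + ((u ⬝ᵥ c) • z - ∑ i, c i • I i) := by
      rw [hcz, hz, h.sum_smul_mul_sum_smul, hdot, hcross, neg_neg]
      simp only [Pi.sub_apply, Pi.smul_apply, sub_smul, Finset.sum_sub_distrib, Finset.smul_sum,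
        smul_assoc]
    rw [hsum]
    abel
  rw [hK]
  exact ((Commute.one_right z).smul_right _).add_right ((Commute.refl z).smul_right _)

end IsQuaternionicTriple

end QuaternionicTriples

section AntilinearPart

variable {R : Type*} [Ring R] [Algebra ℝ R]

/-- For a complex structure `z` (that is, `z * z = -1`), the projection onto the elements that
anticommute with `z`, along those that commute with `z`. On endomorphisms, the latter are the
complex linear and the former the complex antilinear ones. -/
def antilinearPart (z : R) : R →ₗ[ℝ] R :=
  (2⁻¹ : ℝ) • (LinearMap.id + LinearMap.mulLeft ℝ z ∘ₗ LinearMap.mulRight ℝ z)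

lemma antilinearPart_apply (z T : R) : antilinearPart z T = (2⁻¹ : ℝ) • (T + z * (T * z)) := rfl

lemma antilinearPart_mul_left (z T : R) : antilinearPart z (z * T) = z * antilinearPart z T := by
  simp only [antilinearPart_apply, mul_smul_comm, mul_add, mul_assoc]

variable {z : R} (hz : z * z = -1)
include hz

lemma antilinearPart_mul_self (T : R) : antilinearPart z T * z = -(z * antilinearPart z T) := by
  have hzz : z * (z * (T * z)) = -(T * z) := by rw [← mul_assoc, hz, neg_one_mul]
  simp only [antilinearPart_apply, smul_mul_assoc, mul_smul_comm, add_mul, mul_add, mul_assoc, hz,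
    hzz, mul_neg, mul_one, ← smul_neg]
  abel_nf

lemma antilinearPart_eq_self {T : R} (hT : T * z = -(z * T)) : antilinearPart z T = T := by
  rw [antilinearPart_apply, hT, mul_neg, ← mul_assoc, hz, neg_one_mul, neg_neg, ← two_smul ℝ,
    smul_smul, inv_mul_cancel₀ two_ne_zero, one_smul]

lemma antilinearPart_eq_zero_iff {T : R} : antilinearPart z T = 0 ↔ Commute z T := by
  rw [antilinearPart_apply, smul_eq_zero_iff_right (by norm_num)]
  constructor
  · intro h
    have : z * T = z * (-(z * (T * z))) := by rw [← eq_neg_of_add_eq_zero_left h]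
    rw [Commute, SemiconjBy, this, mul_neg, ← mul_assoc, hz, neg_one_mul, neg_neg]
  · intro h
    rw [← h.eq, ← mul_assoc, hz, neg_one_mul, add_neg_cancel]

/-- Both factors of `(z * A - A * z) * B` anticommute with `z`, hence their product commutes
with `z`. -/
lemma antilinearPart_commutator_mul (A : R) {B : R} (hB : B * z = -(z * B)) :
    antilinearPart z ((z * A - A * z) * B) = 0 := by
  have hA : z * (z * A - A * z) = -((z * A - A * z) * z) := by
    simp only [mul_sub, sub_mul, ← mul_assoc, hz]
    simp only [mul_assoc, hz]
    noncomm_ring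
  rw [antilinearPart_eq_zero_iff hz, Commute, SemiconjBy, mul_assoc, hB, ← mul_assoc, hA, mul_neg,
    neg_mul, mul_assoc]

lemma antilinearPart_vertical_eq_zero (A : R) {B : R} (hB : B * z = -(z * B)) :
    antilinearPart z (z * (A * B) + B * (A * z)) +
      z * antilinearPart z (z * (A * (z * B)) + z * B * (A * z)) = 0 := by
  have hzz (T : R) : z * (z * T) = -T := by rw [← mul_assoc, hz, neg_one_mul]
  rw [← antilinearPart_mul_left, ← map_add, ← antilinearPart_commutator_mul hz A hB]
  congr 1
  simp only [mul_add, sub_mul, mul_assoc, hzz]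
  abel

end AntilinearPart

section NormalizedTrace

variable {V : Type*} [NormedAddCommGroup V] [NormedSpace ℝ V]

variable (V) in
/-- The normalized trace `-tr(T) / dim V`, for which quaternionic triples are orthonormal with
respect to `(S, T) ↦ normTrace V (S * T)`. -/
def normTrace : (V →L[ℝ] V) →ₗ[ℝ] ℝ :=
  -(Module.finrank ℝ V : ℝ)⁻¹ • (LinearMap.trace ℝ V ∘ₗ ContinuousLinearMap.coeLM ℝ)

lemma normTrace_apply (T : V →L[ℝ] V) :
    normTrace V T = -LinearMap.trace ℝ V T.toLinearMap / Module.finrank ℝ V := by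
  rw [normTrace, div_eq_inv_mul, mul_neg, ← neg_mul]
  rfl

lemma normTrace_mul_comm (S T : V →L[ℝ] V) : normTrace V (S * T) = normTrace V (T * S) := by
  rw [normTrace_apply, normTrace_apply]
  exact congrArg (-· / _) (LinearMap.trace_mul_comm ℝ S.toLinearMap T.toLinearMap)

lemma normTrace_mul_eq_zero {z K P : V →L[ℝ] V} (hz : z * z = -1) (hK : Commute z K)
    (hP : P * z = -(z * P)) : normTrace V (K * P) = 0 := by
  have hconj : z * (K * P * z) = K * P := by
    rw [mul_assoc, hP, mul_neg, mul_neg, ← mul_assoc K, ← hK.eq, mul_assoc, ← mul_assoc, hz,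
      neg_one_mul, neg_neg]
  have hneg : K * P * z * z = -(K * P) := by rw [mul_assoc, hz, mul_neg_one]
  have := normTrace_mul_comm z (K * P * z)
  rw [hconj, hneg, map_neg] at this
  linarith

lemma IsQuaternionicTriple.normTrace_apply_eq_of_commute {I : Fin 3 → V →L[ℝ] V}
    (h : IsQuaternionicTriple I) {γ : V →L[ℝ] V →L[ℝ] V} {i : Fin 3}
    (hγ : ∀ X, Commute (I i) (γ X + I i * γ (I i X))) (X : V) :
    normTrace V (γ (I (i + 1) X) * I (i + 1)) = normTrace V (γ (I (i + 2) X) * I (i + 2)) := by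
  have horth := normTrace_mul_eq_zero (h.sq i) (hγ (I (i + 1) X))
    (show I (i + 1) * I i = _ by rw [h.succ_mul, h.mul_succ])
  have hmul : I i (I (i + 1) X) = I (i + 2) X := DFunLike.congr_fun (h.mul_succ i) X
  rw [add_mul, map_add, mul_assoc, normTrace_mul_comm (I i), mul_assoc, h.succ_mul, mul_neg,
    map_neg, hmul, ← sub_eq_add_neg, sub_eq_zero] at horth
  exact horth

variable [FiniteDimensional ℝ V] [Nontrivial V]

lemma normTrace_one : normTrace V 1 = -1 := by
  have htr : LinearMap.trace ℝ V (1 : V →L[ℝ] V).toLinearMap = Module.finrank ℝ V :=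
    LinearMap.trace_one ℝ V
  rw [normTrace_apply, htr, neg_div, div_self (by simp [Module.finrank_pos.ne'])]

namespace IsQuaternionicTriple

variable {I : Fin 3 → V →L[ℝ] V} (h : IsQuaternionicTriple I)
include h

lemma normTrace_mul (i j : Fin 3) : normTrace V (I i * I j) = if i = j then 1 else 0 := by
  split_ifs with hij
  · rw [← hij, h.sq, map_neg, normTrace_one, neg_neg]
  · exact normTrace_mul_eq_zero (h.sq i) (Commute.refl _) (h.mul_eq_neg_mul hij)

lemma eq_sum_normTrace_smul {T : V →L[ℝ] V} (hT : T ∈ Submodule.span ℝ (range I)) :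
    T = ∑ i, normTrace V (T * I i) • I i := by
  obtain ⟨u, rfl⟩ := (Submodule.mem_span_range_iff_exists_fun ℝ).1 hT
  simp [Finset.sum_mul, h.normTrace_mul]

theorem forall_commute_iff_normTrace_eq {γ : V →L[ℝ] V →L[ℝ] V}
    (hγ : ∀ X, γ X ∈ Submodule.span ℝ (range I)) :
    (∀ z ∈ Submodule.span ℝ (range I), z * z = -1 → ∀ X, Commute z (γ X + z * γ (z X))) ↔
      ∀ i j X, normTrace V (γ (I i X) * I i) = normTrace V (γ (I j X) * I j) := by
  constructor
  · intro H i j X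
    have hnext (k : Fin 3) := h.normTrace_apply_eq_of_commute
      (H (I k) (Submodule.subset_span (mem_range_self k)) (h.sq k)) X
    have h12 := hnext 0
    have h20 := hnext 1
    fin_cases i <;> fin_cases j <;> simp_all
  · intro H z hz hzz X
    let φ (Y : V) : (V →L[ℝ] V) →ₗ[ℝ] ℝ := -(normTrace V ∘ₗ LinearMap.mulRight ℝ (I 0) ∘ₗ
      (γ ∘L I 0 ∘L ContinuousLinearMap.apply ℝ V Y).toLinearMap)
    have hφ (Y : V) : γ Y = ∑ i, φ Y (I i) • I i := by
      refine (h.eq_sum_normTrace_smul (hγ Y)).trans (Finset.sum_congr rfl fun i _ ↦ ?_)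
      have hY : Y = -I i (I i Y) := by
        rw [show I i (I i Y) = -Y from DFunLike.congr_fun (h.sq i) Y, neg_neg]
      congr 1
      calc normTrace V (γ Y * I i) = -normTrace V (γ (I i (I i Y)) * I i) := by
            nth_rewrite 1 [hY]
            rw [map_neg, neg_mul, map_neg]
        _ = φ Y (I i) := by rw [H i 0]; rfl
    obtain ⟨u, hu⟩ := (Submodule.mem_span_range_iff_exists_fun ℝ).1 hz
    rw [hφ X, hφ (z X)]
    exact h.commute_sum_smul_add_mul (φ X) hu.symm hzz

end IsQuaternionicTriple

end NormalizedTrace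

section AdmissibleBasis

variable {E : Type*} [NormedAddCommGroup E] [NormedSpace ℝ E]
  {M : Type*} [TopologicalSpace M] [ChartedSpace E M] {x : M}
  {Qx : Submodule ℝ (EndT E x)} {J : Fin 3 → EndT E x}

lemma IsAdmissibleBasis.isQuaternionicTriple (hJ : IsAdmissibleBasis Qx J) :
    IsQuaternionicTriple (R := E →L[ℝ] E) J where
  sq := hJ.sq
  mul_zero_one := hJ.mul_zero_one
  mul_one_two := hJ.mul_one_two
  mul_two_zero := hJ.mul_two_zero

lemma IsAdmissibleBasis.mem (hJ : IsAdmissibleBasis Qx J) (i : Fin 3) : J i ∈ Qx :=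
  hJ.span_eq ▸ Submodule.subset_span (mem_range_self i)

lemma metricQ_eq_normTrace (A B : EndT E x) : metricQ A B = normTrace E (A ∘L B) :=
  (normTrace_apply (V := E) (A ∘L B)).symm

lemma IsAdmissibleBasis.eq_sum_metricQ_smul [FiniteDimensional ℝ E] [Nontrivial E]
    (hJ : IsAdmissibleBasis Qx J) {B : EndT E x} (hB : B ∈ Qx) :
    B = ∑ i, metricQ B (J i) • J i := by
  simp only [metricQ_eq_normTrace]
  exact hJ.isQuaternionicTriple.eq_sum_normTrace_smul (V := E) (hJ.span_eq ▸ hB)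

theorem IsAdmissibleBasis.forall_thetaProj_add_eq_zero_iff [FiniteDimensional ℝ E] [Nontrivial E]
    (hJ : IsAdmissibleBasis Qx J) {γ : TangentSpace 𝓘(ℝ, E) x →L[ℝ] EndT E x}
    (hγ : ∀ X, γ X ∈ Qx) :
    (∀ z ∈ Qx, z ∘L z = -ContinuousLinearMap.id ℝ (TangentSpace 𝓘(ℝ, E) x) →
      ∀ X, thetaProj ⟨x, z⟩ (γ X) + z ∘L thetaProj ⟨x, z⟩ (γ (z X)) = 0) ↔
    ∀ i j X, metricQ (γ (J i X)) (J i) = metricQ (γ (J j X)) (J j) := by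
  obtain rfl := hJ.span_eq
  simp only [metricQ_eq_normTrace]
  refine Iff.trans ?_
    (hJ.isQuaternionicTriple.forall_commute_iff_normTrace_eq (V := E) (γ := γ) hγ)
  refine forall₄_congr fun z _ hzz X ↦ ?_
  have hproj : thetaProj ⟨x, z⟩ (γ X) + z ∘L thetaProj ⟨x, z⟩ (γ (z X)) =
      antilinearPart (R := E →L[ℝ] E) z (γ X + z * γ (z X)) := by
    refine Eq.trans ?_ (map_add (antilinearPart (R := E →L[ℝ] E) z) _ _).symm
    exact congrArg _ (antilinearPart_mul_left (R := E →L[ℝ] E) z (γ (z X))).symm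
  rw [hproj]
  exact antilinearPart_eq_zero_iff (R := E →L[ℝ] E) hzz

end AdmissibleBasis

section PenroseProjection

variable {E : Type*} [NormedAddCommGroup E] [NormedSpace ℝ E]
  {M : Type*} [TopologicalSpace M] [ChartedSpace E M] {x : M}
  {Qx : Submodule ℝ (EndT E x)} {J : Fin 3 → EndT E x}

/-- The complex-linear extension to `T_x M ⊗ ℂ` of the `i`-th coordinate `X ↦ ⟨γ(X), J_i⟩` of
`γ ∈ T_x^*M ⊗ Q_x`. -/
def complexCoord (J : Fin 3 → EndT E x) (γ : TangentSpace 𝓘(ℝ, E) x →L[ℝ] EndT E x) (i : Fin 3) :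
    ℂ ⊗[ℝ] TangentSpace 𝓘(ℝ, E) x →ₗ[ℂ] ℂ :=
  LinearMap.liftBaseChange ℂ (Algebra.linearMap ℝ ℂ ∘ₗ normTrace E ∘ₗ
    LinearMap.mulRight ℝ (A := E →L[ℝ] E) (J i) ∘ₗ γ.toLinearMap)

lemma complexCoord_tmul (J : Fin 3 → EndT E x) (γ : TangentSpace 𝓘(ℝ, E) x →L[ℝ] EndT E x)
    (i : Fin 3) (c : ℂ) (X : TangentSpace 𝓘(ℝ, E) x) :
    complexCoord J γ i (c ⊗ₜ X) = c * (metricQ (γ X) (J i) : ℝ) := by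
  rw [metricQ_eq_normTrace]
  exact LinearMap.liftBaseChange_tmul ..

lemma liftBaseChange_toS2 (J : Fin 3 → EndT E x) (γ : TangentSpace 𝓘(ℝ, E) x →L[ℝ] EndT E x) :
    (toS2 J ∘ₗ γ.toLinearMap).liftBaseChange ℂ =
      ∑ i, (complexCoord J γ i).smulRight (sp1 i) := by
  refine TensorProduct.AlgebraTensorModule.ext fun c X ↦ ?_
  simp only [LinearMap.liftBaseChange_tmul, LinearMap.sum_apply, LinearMap.smulRight_apply,
    complexCoord_tmul, mul_smul, ← Finset.smul_sum]
  rfl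

/-- The complex-linear extension of `J_i` to `T_x M ⊗ ℂ`. -/
abbrev complexJ (J : Fin 3 → EndT E x) (i : Fin 3) :
    ℂ ⊗[ℝ] TangentSpace 𝓘(ℝ, E) x →ₗ[ℂ] ℂ ⊗[ℝ] TangentSpace 𝓘(ℝ, E) x :=
  (J i).toLinearMap.baseChange ℂ

lemma complexJ_comp {i j k : Fin 3} (h : J i ∘L J j = J k)
    (v : ℂ ⊗[ℝ] TangentSpace 𝓘(ℝ, E) x) : complexJ J i (complexJ J j v) = complexJ J k v := by
  rw [complexJ, complexJ, ← LinearMap.comp_apply, ← LinearMap.baseChange_comp,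
    ← ContinuousLinearMap.toLinearMap_comp, h]

lemma IsAdmissibleBasis.complexJ_sq (hJ : IsAdmissibleBasis Qx J) (i : Fin 3)
    (v : ℂ ⊗[ℝ] TangentSpace 𝓘(ℝ, E) x) : complexJ J i (complexJ J i v) = -v := by
  rw [complexJ, ← LinearMap.comp_apply, ← LinearMap.baseChange_comp,
    ← ContinuousLinearMap.toLinearMap_comp, hJ.sq, ContinuousLinearMap.toLinearMap_neg,
    LinearMap.baseChange_neg, ContinuousLinearMap.coe_id, LinearMap.baseChange_id,
    LinearMap.neg_apply, LinearMap.id_apply]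

/-- The linear map `H → T_x M ⊗ ℂ` with `h ↦ v` and `h̃ ↦ J₂ v`; it belongs to the fibre of `𝐄` if
`v` is of type `(1, 0)` with respect to `J₁`. -/
def efibreOf (J : Fin 3 → EndT E x) (v : ℂ ⊗[ℝ] TangentSpace 𝓘(ℝ, E) x) :
    Hrep →ₗ[ℂ] ℂ ⊗[ℝ] TangentSpace 𝓘(ℝ, E) x :=
  (EuclideanSpace.basisFun (Fin 2) ℂ).toBasis.constr ℂ ![v, complexJ J 1 v]

lemma efibreOf_apply (v : ℂ ⊗[ℝ] TangentSpace 𝓘(ℝ, E) x) (h : Hrep) :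
    efibreOf J v h = h 0 • v + h 1 • complexJ J 1 v := by
  simp [efibreOf, Module.Basis.constr_apply_fintype]

lemma IsAdmissibleBasis.efibreOf_mem (hJ : IsAdmissibleBasis Qx J)
    {v : ℂ ⊗[ℝ] TangentSpace 𝓘(ℝ, E) x} (hv : complexJ J 0 v = Complex.I • v) :
    efibreOf J v ∈ Efibre J := by
  have h01 : complexJ J 0 (complexJ J 1 v) = complexJ J 2 v := complexJ_comp hJ.mul_zero_one v
  have h20 : complexJ J 2 (complexJ J 0 v) = complexJ J 1 v := complexJ_comp hJ.mul_two_zero v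
  have h2 : complexJ J 2 v = -(Complex.I • complexJ J 1 v) := by
    rw [← h20, hv, map_smul, smul_smul, Complex.I_mul_I, neg_one_smul, neg_neg]
  have h21 : complexJ J 2 (complexJ J 1 v) = -(Complex.I • v) := by
    rw [← h20, hJ.complexJ_sq, hv]
  intro i h
  change _ = complexJ J i _
  fin_cases i <;>
    simp only [Fin.zero_eta, Fin.mk_one, Fin.reduceFinMk, act_sp1_zero, act_sp1_one, act_sp1_two,
      map_add, map_sub, map_neg, map_smul, efibreOf_apply, hb_apply, hv, h01, h2, h21,
      hJ.complexJ_sq, if_true, if_false, zero_ne_one, one_ne_zero] <;>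
    module

/-- `T_x M ⊗ ℂ` is spanned by the values of the elements of the fibre of `𝐄`: write `v` as the sum
of its components of types `(1, 0)` and `(0, 1)` with respect to `J₁`. -/
lemma IsAdmissibleBasis.linearMap_ext_efibre (hJ : IsAdmissibleBasis Qx J)
    {f g : ℂ ⊗[ℝ] TangentSpace 𝓘(ℝ, E) x →ₗ[ℂ] ℂ}
    (h : ∀ e ∈ Efibre J, ∀ a, f (e a) = g (e a)) : f = g := by
  have hfg {v : ℂ ⊗[ℝ] TangentSpace 𝓘(ℝ, E) x} (hv : complexJ J 0 v = Complex.I • v) :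
      f v = g v ∧ f (complexJ J 1 v) = g (complexJ J 1 v) := by
    have hv0 := h _ (hJ.efibreOf_mem hv) (hb 0)
    have hv1 := h _ (hJ.efibreOf_mem hv) (hb 1)
    simp only [efibreOf_apply, hb_apply, if_true, if_false, zero_ne_one, one_ne_zero, one_smul,
      zero_smul, add_zero, zero_add] at hv0 hv1
    exact ⟨hv0, hv1⟩
  refine LinearMap.ext fun v ↦ ?_
  set p := v - Complex.I • complexJ J 0 v with hp
  set m := v + Complex.I • complexJ J 0 v with hm
  have hp0 : complexJ J 0 p = Complex.I • p := by
    rw [hp, map_sub, map_smul, hJ.complexJ_sq, smul_sub, smul_smul, Complex.I_mul_I]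
    module
  have hm0 : complexJ J 0 m = -(Complex.I • m) := by
    rw [hm, map_add, map_smul, hJ.complexJ_sq, smul_add, smul_smul, Complex.I_mul_I]
    module
  have hm1 : complexJ J 0 (complexJ J 1 m) = Complex.I • complexJ J 1 m := by
    have h20 : complexJ J 2 (complexJ J 0 m) = complexJ J 1 m := complexJ_comp hJ.mul_two_zero m
    rw [complexJ_comp hJ.mul_zero_one, ← h20, hm0, map_neg, map_smul, smul_neg, smul_smul,
      Complex.I_mul_I, neg_one_smul, neg_neg]
  have hv : (2 : ℂ) • v = p - complexJ J 1 (complexJ J 1 m) := by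
    rw [hJ.complexJ_sq, hp, hm]
    module
  have h2 : (2 : ℂ) • f v = (2 : ℂ) • g v := by
    rw [← map_smul, ← map_smul, hv, map_sub f p, map_sub g p, (hfg hp0).1, (hfg hm1).2]
  exact smul_right_injective ℂ two_ne_zero h2

lemma penroseProj_apply_eq_zero_iff (γ : TangentSpace 𝓘(ℝ, E) x →L[ℝ] EndT E x) (e : Efibre J) :
    penroseProj J γ e = 0 ↔ ∀ i j h, complexCoord J γ i (complexJ J i (e.1 h)) =
      complexCoord J γ j (complexJ J j (e.1 h)) := by
  have hraise : penroseProj J γ e = S3.orthogonalProjectionOnto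
      (raise (∑ i, (complexCoord J γ i ∘ₗ e.1).smulRight (sp1 i))) := by
    have hsum : (toS2 J ∘ₗ γ.toLinearMap).liftBaseChange ℂ ∘ₗ e.1 =
        ∑ i, (complexCoord J γ i ∘ₗ e.1).smulRight (sp1 i) := by
      ext1 h
      simp only [liftBaseChange_toS2, LinearMap.comp_apply, LinearMap.sum_apply,
        LinearMap.smulRight_apply]
    rw [← hsum]
    rfl
  rw [hraise, Submodule.orthogonalProjectionOnto_eq_zero_iff, raise_mem_S3_orthogonal_iff]
  simp only [LinearMap.comp_apply, e.2 _ _]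

theorem IsAdmissibleBasis.penroseProj_eq_zero_iff (hJ : IsAdmissibleBasis Qx J)
    (γ : TangentSpace 𝓘(ℝ, E) x →L[ℝ] EndT E x) :
    penroseProj J γ = 0 ↔ ∀ i j X, metricQ (γ (J i X)) (J i) = metricQ (γ (J j X)) (J j) := by
  have hvanish : penroseProj J γ = 0 ↔ ∀ i j,
      complexCoord J γ i ∘ₗ complexJ J i = complexCoord J γ j ∘ₗ complexJ J j := by
    refine ⟨fun H i j ↦ hJ.linearMap_ext_efibre fun e he ↦ ?_, fun H ↦ LinearMap.ext fun e ↦ ?_⟩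
    · exact (penroseProj_apply_eq_zero_iff γ ⟨e, he⟩).1 (by rw [H, LinearMap.zero_apply]) i j
    · exact (penroseProj_apply_eq_zero_iff γ e).2 fun i j h ↦ LinearMap.congr_fun (H i j) (e.1 h)
  rw [hvanish]
  refine forall₂_congr fun i j ↦ ⟨fun H X ↦ ?_, fun H ↦ ?_⟩
  · have h1 := LinearMap.congr_fun H (1 ⊗ₜ X)
    simpa [complexCoord_tmul] using h1
  · refine TensorProduct.AlgebraTensorModule.ext fun c X ↦ ?_
    simp [complexCoord_tmul, H X]

end PenroseProjection

section Coordinates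

variable {E : Type*} [NormedAddCommGroup E] [NormedSpace ℝ E]
  {M : Type*} [TopologicalSpace M] [ChartedSpace E M]

variable [IsManifold 𝓘(ℝ, E) ∞ M]

/-- The linear map `T_y M → E` given by the preferred trivialization of `TM` at `p`. -/
def tanCoord (p y : M) : TangentSpace 𝓘(ℝ, E) y →L[ℝ] E :=
  (trivializationAt E (TangentSpace 𝓘(ℝ, E) : M → Type _) p).continuousLinearMapAt ℝ y

/-- The linear map `E → T_y M` given by the inverse of the preferred trivialization of `TM`
at `p`. -/
def tanCoordSymm (p y : M) : E →L[ℝ] TangentSpace 𝓘(ℝ, E) y :=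
  (trivializationAt E (TangentSpace 𝓘(ℝ, E) : M → Type _) p).symmL ℝ y

/-- The fibre coordinate of the preferred trivialization of `End(TM)` at `p`. -/
def endCoord (p y : M) : EndT E y →ₗ[ℝ] E →L[ℝ] E where
  toFun T := tanCoord p y ∘L T ∘L tanCoordSymm p y
  map_add' S T := by simp only [ContinuousLinearMap.add_comp, ContinuousLinearMap.comp_add]
  map_smul' c T := by
    simp only [ContinuousLinearMap.smul_comp, ContinuousLinearMap.comp_smul, RingHom.id_apply]

lemma trivializationAt_endBundle_snd (p y : M) (T : EndT E y) :
    (trivializationAt (E →L[ℝ] E) (EndT E : M → Type _) p (⟨y, T⟩ : EndBundle E M)).2 =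
      endCoord p y T := rfl

variable {p y : M}

lemma tanCoord_tanCoordSymm (hy : y ∈ (chartAt E p).source) (v : E) :
    tanCoord p y (tanCoordSymm p y v) = v :=
  Trivialization.continuousLinearMapAt_symmL _ (by simpa using hy) v

lemma tanCoordSymm_tanCoord (hy : y ∈ (chartAt E p).source) (v : TangentSpace 𝓘(ℝ, E) y) :
    tanCoordSymm p y (tanCoord p y v) = v :=
  Trivialization.symmL_continuousLinearMapAt _ (by simpa using hy) v

lemma tanCoord_self (p : M) (v : TangentSpace 𝓘(ℝ, E) p) : tanCoord p p v = v := by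
  rw [tanCoord, TangentBundle.continuousLinearMapAt_trivializationAt_eq_core (mem_chart_source E p)]
  exact (tangentBundleCore 𝓘(ℝ, E) M).coordChange_self (achart E p) p (mem_chart_source E p) v

lemma tanCoordSymm_self (p : M) (v : E) : tanCoordSymm p p v = v :=
  (congrArg (tanCoordSymm p p) (tanCoord_self p v)).symm.trans
    (tanCoordSymm_tanCoord (mem_chart_source E p) (v : TangentSpace 𝓘(ℝ, E) p))

lemma tanCoord_apply (hy : y ∈ (chartAt E p).source) (v : TangentSpace 𝓘(ℝ, E) y) :
    tanCoord p y v = (trivializationAt E (TangentSpace 𝓘(ℝ, E) : M → Type _) p ⟨y, v⟩).2 := by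
  rw [tanCoord, Trivialization.continuousLinearMapAt_apply,
    Trivialization.coe_linearMapAt_of_mem _ (by simpa using hy)]

lemma tanCoord_extend (hy : y ∈ (chartAt E p).source) (v : TangentSpace 𝓘(ℝ, E) p) :
    tanCoord p y (extend E v y) = v := by
  have hv : (trivializationAt E (TangentSpace 𝓘(ℝ, E) : M → Type _) p ⟨p, v⟩).2 = v :=
    (tanCoord_apply (mem_chart_source E p) v).symm.trans (tanCoord_self p v)
  rw [tanCoord_apply hy, extend, Trivialization.apply_mk_symm _ (by simpa using hy), hv]

lemma endCoord_self (p : M) (T : EndT E p) : endCoord p p T = T := by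
  ext v
  exact (tanCoord_self p _).trans (congrArg T (tanCoordSymm_self p v))

lemma endCoord_comp (hy : y ∈ (chartAt E p).source) (S T : EndT E y) :
    endCoord p y (S ∘L T) = endCoord p y S * endCoord p y T := by
  ext v
  simp [endCoord, tanCoordSymm_tanCoord hy]

lemma endCoord_id (hy : y ∈ (chartAt E p).source) :
    endCoord p y (ContinuousLinearMap.id ℝ (TangentSpace 𝓘(ℝ, E) y)) = 1 := by
  ext v
  simp [endCoord, tanCoord_tanCoordSymm hy]

lemma endCoord_apply_tanCoord (hy : y ∈ (chartAt E p).source) (T : EndT E y)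
    (v : TangentSpace 𝓘(ℝ, E) y) : endCoord p y T (tanCoord p y v) = tanCoord p y (T v) := by
  simp [endCoord, tanCoordSymm_tanCoord hy]

lemma mem_baseSet_trivializationAt_end (hy : y ∈ (chartAt E p).source) :
    y ∈ (trivializationAt (E →L[ℝ] E) (EndT E : M → Type _) p).baseSet := by
  simpa [hom_trivializationAt] using! hy

lemma symmL_trivializationAt_end_self (p : M) (T : E →L[ℝ] E) :
    (trivializationAt (E →L[ℝ] E) (EndT E : M → Type _) p).symmL ℝ p T = T := by
  have hp := mem_baseSet_trivializationAt_end (mem_chart_source E p)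
  have h := Trivialization.symmL_continuousLinearMapAt (R := ℝ)
    (trivializationAt (E →L[ℝ] E) (EndT E : M → Type _) p) hp (T : EndT E p)
  rw [Trivialization.continuousLinearMapAt_apply, Trivialization.coe_linearMapAt_of_mem _ hp] at h
  exact (congrArg _ (endCoord_self p T)).symm.trans h

lemma endCoord_extend (hy : y ∈ (chartAt E p).source) (T : EndT E p) :
    endCoord p y (extend (E →L[ℝ] E) T y) = T := by
  rw [← trivializationAt_endBundle_snd, extend,
    Trivialization.apply_mk_symm _ (mem_baseSet_trivializationAt_end hy)]
  exact endCoord_self p T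

end Coordinates

section Calculus

variable {F : Type*} [NormedAddCommGroup F] [NormedSpace ℝ F] {H : Type*} [TopologicalSpace H]
  {I : ModelWithCorners ℝ F H} {N : Type*} [TopologicalSpace N] [ChartedSpace H N]
  {G G' : Type*} [NormedAddCommGroup G] [NormedSpace ℝ G] [NormedAddCommGroup G'] [NormedSpace ℝ G']
  {x : N}

lemma mvfderiv_congr {f g : N → G} (h : f =ᶠ[𝓝 x] g) : mvfderiv I f x = mvfderiv I g x :=
  h.mfderiv_eq (I := I) (I' := 𝓘(ℝ, G))

lemma mvfderiv_clm_comp (L : G →L[ℝ] G') {f : N → G} (hf : MDifferentiableAt I 𝓘(ℝ, G) f x)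
    (X : TangentSpace I x) : mvfderiv I (fun y ↦ L (f y)) x X = L (mvfderiv I f x X) :=
  DFunLike.congr_fun ((L.hasMFDerivAt (x := f x)).comp x hf.hasMFDerivAt).mfderiv X

lemma mvfderiv_mul_ring {R : Type*} [NormedRing R] [NormedAlgebra ℝ R] {f g : N → R}
    (hf : MDifferentiableAt I 𝓘(ℝ, R) f x) (hg : MDifferentiableAt I 𝓘(ℝ, R) g x)
    (X : TangentSpace I x) :
    mvfderiv I (fun y ↦ f y * g y) x X = f x * mvfderiv I g x X + mvfderiv I f x X * g x :=
  DFunLike.congr_fun (hf.hasMFDerivAt.mul' hg.hasMFDerivAt).mfderiv X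

end Calculus

section ConnectionForm

variable {E : Type*} [NormedAddCommGroup E] [NormedSpace ℝ E]
  {M : Type*} [TopologicalSpace M] [ChartedSpace E M] [IsManifold 𝓘(ℝ, E) ∞ M]

lemma mdifferentiableAt_tanCoord {Y : Π x : M, TangentSpace 𝓘(ℝ, E) x} {p : M}
    (hY : MDiffAt (T% Y) p) :
    MDifferentiableAt 𝓘(ℝ, E) 𝓘(ℝ, E) (fun y ↦ tanCoord p y (Y y)) p := by
  refine ((mdifferentiableAt_section 𝓘(ℝ, E) Y).1 hY).congr_of_eventuallyEq ?_
  filter_upwards [chart_source_mem_nhds E p] with y hy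
  exact tanCoord_apply hy (Y y)

lemma tensorialAt_tanCoord_comp_sub
    (D : CovariantDerivative 𝓘(ℝ, E) E (TangentSpace 𝓘(ℝ, E) : M → Type _)) (p : M) :
    TensorialAt 𝓘(ℝ, E) E (fun Y : Π x : M, TangentSpace 𝓘(ℝ, E) x ↦
      tanCoord p p ∘L D Y p - mvfderiv 𝓘(ℝ, E) (fun y ↦ tanCoord p y (Y y)) p) p where
  smul := by
    intro f Y hf hY
    have hfY : (fun y ↦ tanCoord p y ((f • Y) y)) = f • fun y ↦ tanCoord p y (Y y) :=
      funext fun y ↦ map_smul (tanCoord p y) (f y) (Y y)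
    rw [hfY, mvfderiv_smul hf (mdifferentiableAt_tanCoord hY),
      D.isCovariantDerivativeOnUniv.leibniz hY hf]
    ext v
    simp only [ContinuousLinearMap.comp_add, ContinuousLinearMap.comp_smulₛₗ, Real.ringHom_apply,
      sub_apply, add_apply, smul_apply, ContinuousLinearMap.comp_apply,
      ContinuousLinearMap.smulRight_apply, map_smul, add_sub_add_right_eq_sub]
    module
  add := by
    intro Y Y' hY hY'
    have hYY' : (fun y ↦ tanCoord p y ((Y + Y') y)) =
        (fun y ↦ tanCoord p y (Y y)) + fun y ↦ tanCoord p y (Y' y) :=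
      funext fun y ↦ map_add (tanCoord p y) (Y y) (Y' y)
    rw [hYY', mvfderiv_add (mdifferentiableAt_tanCoord hY) (mdifferentiableAt_tanCoord hY'),
      D.isCovariantDerivativeOnUniv.add hY hY', ContinuousLinearMap.comp_add,
      add_sub_add_comm]

variable [FiniteDimensional ℝ E]

/-- The connection form of `D` at `p`, that is, the difference between `D` and the flat connection
of the preferred trivialization of `TM` at `p`. The tangent space `T_p M` is identified with `E`
by this trivialization. -/
def connForm (D : CovariantDerivative 𝓘(ℝ, E) E (TangentSpace 𝓘(ℝ, E) : M → Type _)) (p : M) :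
    E →L[ℝ] E →L[ℝ] E :=
  ContinuousLinearMap.flip (E := E) (F := E) (G := E)
    (TensorialAt.mkHom _ p (tensorialAt_tanCoord_comp_sub D p))

variable (D : CovariantDerivative 𝓘(ℝ, E) E (TangentSpace 𝓘(ℝ, E) : M → Type _)) {p : M}

lemma covariantDerivative_eq {Y : Π x : M, TangentSpace 𝓘(ℝ, E) x}
    (hY : MDiffAt (T% Y) p) (X : TangentSpace 𝓘(ℝ, E) p) :
    tanCoord p p (D Y p X) =
      mvfderiv 𝓘(ℝ, E) (fun y ↦ tanCoord p y (Y y)) p X + connForm D p X (Y p) := by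
  have h : connForm D p X (Y p) = tanCoord p p (D Y p X) -
      mvfderiv 𝓘(ℝ, E) (fun y ↦ tanCoord p y (Y y)) p X :=
    DFunLike.congr_fun (TensorialAt.mkHom_apply (tensorialAt_tanCoord_comp_sub D p) hY) X
  rw [h, add_sub_cancel]

lemma covariantDerivative_extend (v X : TangentSpace 𝓘(ℝ, E) p) :
    tanCoord p p (D (extend E v) p X) = connForm D p X v := by
  have h : (fun y ↦ tanCoord p y (extend E v y)) =ᶠ[𝓝 p] fun _ ↦ tanCoord p p v := by
    filter_upwards [chart_source_mem_nhds E p] with y hy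
    rw [tanCoord_extend hy, tanCoord_self]
  rw [covariantDerivative_eq D (mdifferentiableAt_extend 𝓘(ℝ, E) E v) X, extend_apply_self,
    mvfderiv_congr h, mvfderiv_const, zero_apply, zero_add]

/-- The connection form at `p` of the connection induced by `D` on `End(TM)`: at `X` it is the
commutator with `connForm D p X`. -/
def endConnForm (p : M) : E →ₗ[ℝ] (E →L[ℝ] E) →ₗ[ℝ] E →L[ℝ] E :=
  (LinearMap.mul ℝ (E →L[ℝ] E) - (LinearMap.mul ℝ (E →L[ℝ] E)).flip) ∘ₗ
    (connForm D p).toLinearMap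

lemma endConnForm_apply (X : E) (T : E →L[ℝ] E) :
    endConnForm D p X T = connForm D p X * T - T * connForm D p X := rfl

lemma endConnForm_mul (X : E) (S T : E →L[ℝ] E) :
    endConnForm D p X (S * T) = S * endConnForm D p X T + endConnForm D p X S * T := by
  simp only [endConnForm_apply]
  noncomm_ring

theorem endCoord_endCov {A : Π x : M, EndT E x}
    (hA : MDifferentiableAt 𝓘(ℝ, E) (endModel E) (secMap A) p) (X : TangentSpace 𝓘(ℝ, E) p) :
    endCoord p p (endCov D A p X) = mvfderiv 𝓘(ℝ, E) (fun y ↦ endCoord p y (A y)) p X +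
      endConnForm D p X (endCoord p p (A p)) := by
  refine ContinuousLinearMap.ext fun v ↦ ?_
  let w : TangentSpace 𝓘(ℝ, E) p := v
  have hw := mdifferentiableAt_extend 𝓘(ℝ, E) E w
  have hcoord : (fun y ↦ tanCoord p y (A y (extend E w y))) =ᶠ[𝓝 p]
      fun y ↦ endCoord p y (A y) v := by
    filter_upwards [chart_source_mem_nhds E p] with y hy
    rw [← endCoord_apply_tanCoord hy, tanCoord_extend hy]
  have hderiv : mvfderiv 𝓘(ℝ, E) (fun y ↦ endCoord p y (A y) v) p X =
      mvfderiv 𝓘(ℝ, E) (fun y ↦ endCoord p y (A y)) p X v :=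
    mvfderiv_clm_comp (ContinuousLinearMap.apply ℝ E v)
      ((mdifferentiableAt_section 𝓘(ℝ, E) A).1 hA) X
  have hcov := endCov_apply D A p hA _ hw X
  have hAw := covariantDerivative_eq D (hA.clm_bundle_apply hw) X
  rw [mvfderiv_congr hcoord, hderiv, extend_apply_self] at hAw
  rw [extend_apply_self] at hcov
  calc endCoord p p (endCov D A p X) v = tanCoord p p (endCov D A p X w) := by
        rw [← endCoord_apply_tanCoord (mem_chart_source E p), tanCoord_self]
    _ = tanCoord p p (D (fun y ↦ A y (extend E w y)) p X) -
          endCoord p p (A p) (tanCoord p p (D (extend E w) p X)) := by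
        rw [hcov, map_sub, endCoord_apply_tanCoord (mem_chart_source E p)]
    _ = mvfderiv 𝓘(ℝ, E) (fun y ↦ endCoord p y (A y)) p X v +
          (connForm D p X (A p w) - endCoord p p (A p) (connForm D p X v)) := by
        rw [hAw, covariantDerivative_extend, add_sub_assoc]
    _ = _ := by rw [endCoord_self]; rfl

end ConnectionForm

section Lifts

variable {E : Type*} [NormedAddCommGroup E] [NormedSpace ℝ E]
  {M : Type*} [TopologicalSpace M] [ChartedSpace E M] [IsManifold 𝓘(ℝ, E) ∞ M]

lemma mdifferentiableAt_endCoord (z : EndBundle E M) :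
    MDifferentiableAt (endModel E) 𝓘(ℝ, E →L[ℝ] E)
      (fun w : EndBundle E M ↦ endCoord z.proj w.proj w.2) z :=
  ((mdifferentiableAt_totalSpace 𝓘(ℝ, E) (fun w : EndBundle E M ↦ w)).1 mdifferentiableAt_id).2

/-- The differential at `z` of the fibre coordinate `endCoord z.proj`. Together with `projDeriv`
it determines a tangent vector of the total space of `End(TM)`. -/
def fibreDeriv (z : EndBundle E M) : TangentSpace (endModel E) z →L[ℝ] E →L[ℝ] E :=
  mvfderiv (endModel E) (fun w ↦ endCoord z.proj w.proj w.2) z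

/-- The preferred charts of the total space are built from the preferred trivializations. -/
lemma hasMFDerivAt_trivializationAt (z : EndBundle E M) :
    HasMFDerivAt (endModel E) (endModel E)
      (trivializationAt (E →L[ℝ] E) (EndT E : M → Type _) z.proj : EndBundle E M → _) z
      (ContinuousLinearMap.id ℝ (E × (E →L[ℝ] E))) := by
  refine ⟨(trivializationAt (E →L[ℝ] E) (EndT E : M → Type _) z.proj).continuousAt (by simp),
    (hasFDerivWithinAt_id _ _).congr_of_eventuallyEq ?_
      (writtenInExtChartAt_trivializationAt (mem_extChartAt_target z))⟩
  filter_upwards [extChartAt_target_mem_nhdsWithin (I := endModel E) z] with y hy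
  exact writtenInExtChartAt_trivializationAt hy

variable {z : EndBundle E M}

lemma eq_of_projDeriv_eq_of_fibreDeriv_eq {U V : TangentSpace (endModel E) z}
    (hproj : projDeriv z U = projDeriv z V) (hfibre : fibreDeriv z U = fibreDeriv z V) :
    U = V := by
  have htriv := hasMFDerivAt_trivializationAt z
  have hfst : (TotalSpace.proj : EndBundle E M → M) =ᶠ[𝓝 z] Prod.fst ∘
      (trivializationAt (E →L[ℝ] E) (EndT E : M → Type _) z.proj : EndBundle E M → _) := by
    filter_upwards [(trivializationAt (E →L[ℝ] E) (EndT E : M → Type _)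
      z.proj).open_source.mem_nhds (by simp)] with w hw
    exact (Trivialization.coe_fst _ hw).symm
  have h₁ := ((hasMFDerivAt_fst (I := 𝓘(ℝ, E)) (I' := 𝓘(ℝ, E →L[ℝ] E)) _).comp z
    htriv).congr_of_eventuallyEq hfst |>.mfderiv
  have h₂ := ((hasMFDerivAt_snd (I := 𝓘(ℝ, E)) (I' := 𝓘(ℝ, E →L[ℝ] E)) _).comp z htriv).mfderiv
  refine Prod.ext (α := E) (β := E →L[ℝ] E) ?_ ?_
  · exact (DFunLike.congr_fun h₁ U).symm.trans (hproj.trans (DFunLike.congr_fun h₁ V))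
  · exact (DFunLike.congr_fun h₂ U).symm.trans (hfibre.trans (DFunLike.congr_fun h₂ V))

section Maps

variable {F : Type*} [NormedAddCommGroup F] [NormedSpace ℝ F] {H : Type*} [TopologicalSpace H]
  {I : ModelWithCorners ℝ F H} {N : Type*} [TopologicalSpace N] [ChartedSpace H N]
  {f : N → EndBundle E M} {y : N}

lemma projDeriv_mfderiv (hz : f y = z) (hf : MDifferentiableAt I (endModel E) f y)
    (X : TangentSpace I y) :
    projDeriv z (mfderiv I (endModel E) f y X) = mfderiv I 𝓘(ℝ, E) (fun y' ↦ (f y').proj) y X := by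
  subst hz
  exact (mfderiv_comp_apply y (mdifferentiableAt_proj (EndT E : M → Type _)) hf X).symm

lemma fibreDeriv_mfderiv (hz : f y = z) (hf : MDifferentiableAt I (endModel E) f y)
    (X : TangentSpace I y) :
    fibreDeriv z (mfderiv I (endModel E) f y X) =
      mvfderiv I (fun y' ↦ endCoord z.proj (f y').proj (f y').2) y X := by
  subst hz
  exact (mfderiv_comp_apply y (mdifferentiableAt_endCoord (f y)) hf X).symm

end Maps

lemma mvfderiv_endCoord_extend {p : M} (T : EndT E p) :
    mvfderiv 𝓘(ℝ, E) (fun y ↦ endCoord p y (extend (E →L[ℝ] E) T y)) p = 0 := by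
  have h : (fun y ↦ endCoord p y (extend (E →L[ℝ] E) T y)) =ᶠ[𝓝 p] fun _ ↦ endCoord p p T := by
    filter_upwards [chart_source_mem_nhds E p] with y hy
    rw [endCoord_extend hy T, endCoord_self]
  rw [mvfderiv_congr h, mvfderiv_const]

lemma projDeriv_sectionLift (X : TangentSpace 𝓘(ℝ, E) z.proj) :
    projDeriv z (sectionLift z X) = X := by
  have hz : secMap (extend (E →L[ℝ] E) z.2) z.proj = z := by rw [secMap, extend_apply_self]
  refine (projDeriv_mfderiv hz (mdifferentiableAt_extend 𝓘(ℝ, E) (E →L[ℝ] E) z.2) X).trans ?_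
  exact DFunLike.congr_fun (mfderiv_id (I := 𝓘(ℝ, E)) (x := z.proj)) X

lemma fibreDeriv_sectionLift (X : TangentSpace 𝓘(ℝ, E) z.proj) :
    fibreDeriv z (sectionLift z X) = 0 := by
  have hz : secMap (extend (E →L[ℝ] E) z.2) z.proj = z := by rw [secMap, extend_apply_self]
  refine (fibreDeriv_mfderiv hz (mdifferentiableAt_extend 𝓘(ℝ, E) (E →L[ℝ] E) z.2) X).trans ?_
  exact DFunLike.congr_fun (mvfderiv_endCoord_extend z.2) X

lemma hasDerivAt_endCoord_add_smul (B : EndT E z.proj) :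
    HasDerivAt (fun t : ℝ ↦ endCoord z.proj z.proj (z.2 + t • B)) (endCoord z.proj z.proj B) 0 := by
  simpa only [map_add, map_smul, one_smul] using!
    ((hasDerivAt_id' (0 : ℝ)).smul_const (endCoord z.proj z.proj B)).const_add
      (endCoord z.proj z.proj z.2)

lemma mdifferentiableAt_add_smul (B : EndT E z.proj) :
    MDifferentiableAt 𝓘(ℝ, ℝ) (endModel E)
      (fun t : ℝ ↦ (⟨z.proj, z.2 + t • B⟩ : EndBundle E M)) 0 :=
  (mdifferentiableAt_totalSpace _ _).2 ⟨mdifferentiableAt_const,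
    (hasDerivAt_endCoord_add_smul B).differentiableAt.mdifferentiableAt⟩

lemma projDeriv_verticalLift (B : EndT E z.proj) : projDeriv z (verticalLift z B) = 0 := by
  refine (projDeriv_mfderiv (z := z) (by simp) (mdifferentiableAt_add_smul B) (1 : ℝ)).trans ?_
  exact DFunLike.congr_fun (mfderiv_const (I := 𝓘(ℝ, ℝ)) (I' := 𝓘(ℝ, E)) (c := z.proj)
    (x := (0 : ℝ))) (1 : ℝ)

lemma fibreDeriv_verticalLift (B : EndT E z.proj) :
    fibreDeriv z (verticalLift z B) = endCoord z.proj z.proj B := by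
  refine (fibreDeriv_mfderiv (z := z) (by simp) (mdifferentiableAt_add_smul B) (1 : ℝ)).trans ?_
  refine (DFunLike.congr_fun
    (hasDerivAt_endCoord_add_smul B).hasFDerivAt.hasMFDerivAt.mfderiv (1 : ℝ)).trans ?_
  exact one_smul ℝ (endCoord z.proj z.proj B)

variable [FiniteDimensional ℝ E]
  (D : CovariantDerivative 𝓘(ℝ, E) E (TangentSpace 𝓘(ℝ, E) : M → Type _))

lemma endCoord_endCov_extend {p : M} (T : EndT E p) (X : TangentSpace 𝓘(ℝ, E) p) :
    endCoord p p (endCov D (extend (E →L[ℝ] E) T) p X) =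
      endConnForm D p X (endCoord p p T) := by
  rw [endCoord_endCov D (mdifferentiableAt_extend 𝓘(ℝ, E) (E →L[ℝ] E) T),
    mvfderiv_endCoord_extend, zero_apply, zero_add, extend_apply_self]

lemma endCoord_pullbackCov (S : Set (EndBundle E M)) (s : Π z : EndBundle E M, EndT E z.proj)
    (U : TangentSpace (endModel E) z) :
    endCoord z.proj z.proj (pullbackCov D S s z U) =
      mvfderivWithin (endModel E) (fun w ↦ endCoord z.proj w.proj (s w)) S z U +
      endConnForm D z.proj (projDeriv z U) (endCoord z.proj z.proj (s z)) := by
  rw [pullbackCov, map_add, endCoord_endCov_extend, endCoord_self, symmL_trivializationAt_end_self]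
  rfl

lemma endCoord_verticalPart (U : TangentSpace (endModel E) z) :
    endCoord z.proj z.proj (verticalPart D z U) = fibreDeriv z U +
      endConnForm D z.proj (projDeriv z U) (endCoord z.proj z.proj z.2) := by
  rw [verticalPart, endCoord_pullbackCov, mvfderivWithin_univ, fibreDeriv]

lemma eq_of_projDeriv_eq_of_verticalPart_eq {U V : TangentSpace (endModel E) z}
    (hproj : projDeriv z U = projDeriv z V) (hvert : verticalPart D z U = verticalPart D z V) :
    U = V := by
  refine eq_of_projDeriv_eq_of_fibreDeriv_eq hproj ?_
  have h := congrArg (endCoord z.proj z.proj) hvert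
  rwa [endCoord_verticalPart, endCoord_verticalPart, hproj, add_left_inj] at h

lemma projDeriv_horizontalLift (X : TangentSpace 𝓘(ℝ, E) z.proj) :
    projDeriv z (horizontalLift D z X) = X := by
  refine (map_sub (mfderiv (endModel E) 𝓘(ℝ, E) (TotalSpace.proj : EndBundle E M → M) z)
    _ _).trans ?_
  refine (congrArg₂ _ (projDeriv_sectionLift X) (projDeriv_verticalLift _)).trans ?_
  exact sub_zero X

lemma fibreDeriv_horizontalLift (X : TangentSpace 𝓘(ℝ, E) z.proj) :
    fibreDeriv z (horizontalLift D z X) =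
      -endConnForm D z.proj X (endCoord z.proj z.proj z.2) := by
  rw [horizontalLift, ContinuousLinearMap.map_sub, fibreDeriv_sectionLift, fibreDeriv_verticalLift,
    endCoord_endCov_extend, zero_sub]

lemma verticalPart_horizontalLift (X : TangentSpace 𝓘(ℝ, E) z.proj) :
    verticalPart D z (horizontalLift D z X) = 0 := by
  have h := endCoord_verticalPart D (horizontalLift D z X)
  rw [fibreDeriv_horizontalLift, projDeriv_horizontalLift, neg_add_cancel, endCoord_self] at h
  exact h

lemma projDeriv_twistorJ (U : TangentSpace (endModel E) z) :
    projDeriv z (twistorJ D z U) = z.2 (projDeriv z U) := by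
  refine (map_add (mfderiv (endModel E) 𝓘(ℝ, E) (TotalSpace.proj : EndBundle E M → M) z)
    _ _).trans ?_
  refine (congrArg₂ _ (projDeriv_horizontalLift D _) (projDeriv_verticalLift _)).trans ?_
  exact add_zero (z.2 (projDeriv z U))

lemma verticalPart_twistorJ (U : TangentSpace (endModel E) z) :
    verticalPart D z (twistorJ D z U) = z.2 ∘L verticalPart D z U := by
  have h := endCoord_verticalPart D (twistorJ D z U)
  rw [projDeriv_twistorJ, twistorJ, ContinuousLinearMap.map_add, fibreDeriv_horizontalLift,
    fibreDeriv_verticalLift, neg_add_cancel_comm, endCoord_self, endCoord_self] at h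
  exact h

end Lifts

section CovAlong

variable {E : Type*} [NormedAddCommGroup E] [NormedSpace ℝ E]
  {M : Type*} [TopologicalSpace M] [ChartedSpace E M]
  {F : Type*} [NormedAddCommGroup F] [NormedSpace ℝ F] {H : Type*} [TopologicalSpace H]
  {I : ModelWithCorners ℝ F H} {N : Type*} [TopologicalSpace N] [ChartedSpace H N]

/-- A section of `End(TM)` along a map `φ : N → M`, viewed as a map into the total space. -/
abbrev secAlong (φ : N → M) (s : Π y : N, EndT E (φ y)) (y : N) : EndBundle E M := ⟨φ y, s y⟩

variable [IsManifold 𝓘(ℝ, E) ∞ M] {φ : N → M} {y : N}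

lemma contMDiffAt_secAlong {n : ℕ∞ω} {s : Π y : N, EndT E (φ y)} :
    ContMDiffAt I (endModel E) n (secAlong φ s) y ↔ ContMDiffAt I 𝓘(ℝ, E) n φ y ∧
      ContMDiffAt I 𝓘(ℝ, E →L[ℝ] E) n (fun y' ↦ endCoord (φ y) (φ y') (s y')) y :=
  contMDiffAt_totalSpace

lemma mdifferentiableAt_secAlong {s : Π y : N, EndT E (φ y)} :
    MDifferentiableAt I (endModel E) (secAlong φ s) y ↔ MDifferentiableAt I 𝓘(ℝ, E) φ y ∧
      MDifferentiableAt I 𝓘(ℝ, E →L[ℝ] E) (fun y' ↦ endCoord (φ y) (φ y') (s y')) y :=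
  mdifferentiableAt_totalSpace _ _

lemma contMDiffAt_secAlong_add {n : ℕ∞ω} {s t : Π y : N, EndT E (φ y)}
    (hs : ContMDiffAt I (endModel E) n (secAlong φ s) y)
    (ht : ContMDiffAt I (endModel E) n (secAlong φ t) y) :
    ContMDiffAt I (endModel E) n (secAlong φ fun y' ↦ s y' + t y') y := by
  rw [contMDiffAt_secAlong] at hs ht ⊢
  exact ⟨hs.1, by simpa only [map_add] using! hs.2.add ht.2⟩

lemma contMDiffAt_secAlong_smul {n : ℕ∞ω} {c : N → ℝ} {s : Π y : N, EndT E (φ y)}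
    (hc : ContMDiffAt I 𝓘(ℝ) n c y) (hs : ContMDiffAt I (endModel E) n (secAlong φ s) y) :
    ContMDiffAt I (endModel E) n (secAlong φ fun y' ↦ c y' • s y') y := by
  rw [contMDiffAt_secAlong] at hs ⊢
  exact ⟨hs.1, by simpa only [map_smul] using! hc.smul hs.2⟩

lemma contMDiffAt_secAlong_sum {n : ℕ∞ω} {ι : Type*} {u : Finset ι}
    {s : ι → Π y : N, EndT E (φ y)} (hφ : ContMDiffAt I 𝓘(ℝ, E) n φ y)
    (hs : ∀ i ∈ u, ContMDiffAt I (endModel E) n (secAlong φ (s i)) y) :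
    ContMDiffAt I (endModel E) n (secAlong φ fun y' ↦ ∑ i ∈ u, s i y') y := by
  simp only [contMDiffAt_secAlong] at hs ⊢
  exact ⟨hφ, by simpa only [map_sum] using contMDiffAt_finsetSum fun i hi ↦ (hs i hi).2⟩

lemma contMDiffAt_secAlong_comp {n : ℕ∞ω} {s t : Π y : N, EndT E (φ y)}
    (hs : ContMDiffAt I (endModel E) n (secAlong φ s) y)
    (ht : ContMDiffAt I (endModel E) n (secAlong φ t) y) :
    ContMDiffAt I (endModel E) n (secAlong φ fun y' ↦ s y' ∘L t y') y := by
  rw [contMDiffAt_secAlong] at hs ht ⊢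
  refine ⟨hs.1, (hs.2.clm_comp ht.2).congr_of_eventuallyEq ?_⟩
  filter_upwards [hs.1.continuousAt (chart_source_mem_nhds E (φ y))] with y' hy'
  exact endCoord_comp hy' _ _

lemma mvfderivWithin_twistorSpace {G : Type*} [NormedAddCommGroup G] [NormedSpace ℝ G]
    {Q : Π x : M, Submodule ℝ (EndT E x)} {z : EndBundle E M} {f : EndBundle E M → G}
    (hf : MDifferentiableAt (endModel E) 𝓘(ℝ, G) f z) {U : TangentSpace (endModel E) z}
    (hU : U ∈ twistorTangent Q z) :
    mvfderivWithin (endModel E) f (twistorSpace Q) z U = mvfderiv (endModel E) f z U := by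
  obtain ⟨c, hc, hcZ, rfl, rfl⟩ := hU
  have hc' := (hc.mdifferentiableAt (by simp)).hasMFDerivAt
  have hwithin := (hf.mdifferentiableWithinAt (s := twistorSpace Q)).hasMFDerivWithinAt.comp 0
    (hc'.hasMFDerivWithinAt (s := c ⁻¹' twistorSpace Q)) subset_rfl
  exact DFunLike.congr_fun
    (hasMFDerivAt_unique (hwithin.hasMFDerivAt hcZ) (hf.hasMFDerivAt.comp 0 hc')) (1 : ℝ)

lemma endCoord_injective (p : M) : Function.Injective (endCoord (E := E) p p) :=
  fun S T h ↦ (endCoord_self p S).symm.trans (h.trans (endCoord_self p T))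

variable [FiniteDimensional ℝ E]

/-- The section `s` of `φ^*End(TM)` is differentiable at `y`, and `s' X` is its covariant
derivative in the direction `X`: the vertical part of the velocity of `s` in the total space. -/
structure HasCovDerivAt (D : CovariantDerivative 𝓘(ℝ, E) E (TangentSpace 𝓘(ℝ, E) : M → Type _))
    (φ : N → M) (s : Π y : N, EndT E (φ y)) (y : N) (s' : TangentSpace I y → EndT E (φ y)) :
    Prop where
  mdifferentiableAt : MDifferentiableAt I (endModel E) (secAlong φ s) y
  verticalPart_mfderiv : ∀ X,
    verticalPart D (secAlong φ s y) (mfderiv I (endModel E) (secAlong φ s) y X) = s' X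

variable {D : CovariantDerivative 𝓘(ℝ, E) E (TangentSpace 𝓘(ℝ, E) : M → Type _)}
  {s t : Π y : N, EndT E (φ y)} {s' t' : TangentSpace I y → EndT E (φ y)}

lemma endCoord_verticalPart_mfderiv (hs : MDifferentiableAt I (endModel E) (secAlong φ s) y)
    (X : TangentSpace I y) :
    endCoord (φ y) (φ y)
        (verticalPart D (secAlong φ s y) (mfderiv I (endModel E) (secAlong φ s) y X)) =
      mvfderiv I (fun y' ↦ endCoord (φ y) (φ y') (s y')) y X +
        endConnForm D (φ y) (mfderiv I 𝓘(ℝ, E) φ y X) (endCoord (φ y) (φ y) (s y)) := by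
  have h := endCoord_verticalPart D (mfderiv I (endModel E) (secAlong φ s) y X)
  rwa [fibreDeriv_mfderiv (z := secAlong φ s y) rfl hs,
    projDeriv_mfderiv (z := secAlong φ s y) rfl hs] at h

lemma hasCovDerivAt_iff : HasCovDerivAt D φ s y s' ↔
    MDifferentiableAt I 𝓘(ℝ, E) φ y ∧
      MDifferentiableAt I 𝓘(ℝ, E →L[ℝ] E) (fun y' ↦ endCoord (φ y) (φ y') (s y')) y ∧
      ∀ X, endCoord (φ y) (φ y) (s' X) =
        mvfderiv I (fun y' ↦ endCoord (φ y) (φ y') (s y')) y X +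
          endConnForm D (φ y) (mfderiv I 𝓘(ℝ, E) φ y X) (endCoord (φ y) (φ y) (s y)) := by
  rw [← and_assoc, ← mdifferentiableAt_secAlong]
  refine ⟨fun hs ↦ ⟨hs.1, fun X ↦ ?_⟩, fun hs ↦ ⟨hs.1, fun X ↦ endCoord_injective _ ?_⟩⟩
  · rw [← hs.2 X]
    exact endCoord_verticalPart_mfderiv hs.1 X
  · exact (endCoord_verticalPart_mfderiv hs.1 X).trans (hs.2 X).symm

namespace HasCovDerivAt

lemma congr_of_eventuallyEq (hs : HasCovDerivAt D φ s y s')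
    (h : ∀ᶠ y' in 𝓝 y, s y' = t y') : HasCovDerivAt D φ t y s' := by
  have hy : s y = t y := h.self_of_nhds
  have h' : (fun y' ↦ endCoord (φ y) (φ y') (t y')) =ᶠ[𝓝 y]
      fun y' ↦ endCoord (φ y) (φ y') (s y') := h.mono fun y' hy' ↦ congrArg _ hy'.symm
  rw [hasCovDerivAt_iff] at hs ⊢
  refine ⟨hs.1, hs.2.1.congr_of_eventuallyEq h', fun X ↦ ?_⟩
  rw [mvfderiv_congr h', ← hy, hs.2.2]

lemma unique (hs : HasCovDerivAt D φ s y s') (ht : HasCovDerivAt D φ s y t') : s' = t' :=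
  funext fun X ↦ (hs.verticalPart_mfderiv X).symm.trans (ht.verticalPart_mfderiv X)

lemma add (hs : HasCovDerivAt D φ s y s') (ht : HasCovDerivAt D φ t y t') :
    HasCovDerivAt D φ (fun y' ↦ s y' + t y') y (fun X ↦ s' X + t' X) := by
  rw [hasCovDerivAt_iff] at hs ht ⊢
  refine ⟨hs.1, by simpa only [map_add] using! hs.2.1.add ht.2.1, fun X ↦ ?_⟩
  simp only [map_add, hs.2.2 X, ht.2.2 X, mvfderiv_fun_add hs.2.1 ht.2.1, add_apply]
  abel

lemma smul {c : N → ℝ} (hc : MDifferentiableAt I 𝓘(ℝ) c y) (hs : HasCovDerivAt D φ s y s') :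
    HasCovDerivAt D φ (fun y' ↦ c y' • s y') y
      (fun X ↦ mvfderiv I c y X • s y + c y • s' X) := by
  rw [hasCovDerivAt_iff] at hs ⊢
  refine ⟨hs.1, by simpa only [map_smul] using! hc.smul hs.2.1, fun X ↦ ?_⟩
  simp only [map_add, map_smul, hs.2.2 X, mvfderiv_fun_smul hc hs.2.1, add_apply,
    smul_apply, ContinuousLinearMap.smulRight_apply]
  module

lemma sum {ι : Type*} {u : Finset ι} {s : ι → Π y : N, EndT E (φ y)}
    {s' : ι → TangentSpace I y → EndT E (φ y)} (hφ : MDifferentiableAt I 𝓘(ℝ, E) φ y)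
    (hs : ∀ i ∈ u, HasCovDerivAt D φ (s i) y (s' i)) :
    HasCovDerivAt D φ (fun y' ↦ ∑ i ∈ u, s i y') y (fun X ↦ ∑ i ∈ u, s' i X) := by
  classical
  induction u using Finset.induction_on with
  | empty =>
    simp only [Finset.sum_empty, hasCovDerivAt_iff, map_zero, mvfderiv_const, zero_apply, add_zero,
      implies_true, and_true]
    exact ⟨hφ, mdifferentiableAt_const⟩
  | insert i u hi ih =>
    simp only [Finset.sum_insert hi]
    exact (hs i (Finset.mem_insert_self i u)).add
      (ih fun j hj ↦ hs j (Finset.mem_insert_of_mem hj))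

lemma comp (hs : HasCovDerivAt D φ s y s') (ht : HasCovDerivAt D φ t y t') :
    HasCovDerivAt D φ (fun y' ↦ s y' ∘L t y') y (fun X ↦ s y ∘L t' X + s' X ∘L t y) := by
  rw [hasCovDerivAt_iff] at hs ht ⊢
  have h : (fun y' ↦ endCoord (φ y) (φ y') (s y' ∘L t y')) =ᶠ[𝓝 y]
      fun y' ↦ endCoord (φ y) (φ y') (s y') * endCoord (φ y) (φ y') (t y') := by
    filter_upwards [hs.1.continuousAt (chart_source_mem_nhds E (φ y))] with y' hy'
    exact endCoord_comp hy' _ _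
  refine ⟨hs.1, (hs.2.1.mul ht.2.1).congr_of_eventuallyEq h, fun X ↦ ?_⟩
  have hy := mem_chart_source E (φ y)
  rw [mvfderiv_congr h, mvfderiv_mul_ring hs.2.1 ht.2.1, map_add, endCoord_comp hy,
    endCoord_comp hy, endCoord_comp hy, hs.2.2, ht.2.2, mul_add, add_mul]
  refine Eq.trans ?_ (congrArg _ (endConnForm_mul D _ _ _)).symm
  abel

lemma comp_map {F' : Type*} [NormedAddCommGroup F'] [NormedSpace ℝ F'] {H' : Type*}
    [TopologicalSpace H'] {I' : ModelWithCorners ℝ F' H'} {N' : Type*} [TopologicalSpace N']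
    [ChartedSpace H' N'] {ψ : N' → N} {x : N'} {s' : TangentSpace I (ψ x) → EndT E (φ (ψ x))}
    (hs : HasCovDerivAt D φ s (ψ x) s') (hψ : MDifferentiableAt I' I ψ x) :
    HasCovDerivAt D (fun x' ↦ φ (ψ x')) (fun x' ↦ s (ψ x')) x
      (fun X ↦ s' (mfderiv I' I ψ x X)) where
  mdifferentiableAt := hs.1.comp x hψ
  verticalPart_mfderiv X := by
    rw [← hs.verticalPart_mfderiv]
    exact congrArg _ (mfderiv_comp_apply x hs.1 hψ X)

end HasCovDerivAt

lemma hasCovDerivAt_id (hφ : MDifferentiableAt I 𝓘(ℝ, E) φ y) :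
    HasCovDerivAt D φ (fun _ ↦ ContinuousLinearMap.id ℝ _) y
      (fun _ : TangentSpace I y ↦ 0) := by
  have h : (fun y' ↦ endCoord (φ y) (φ y') (ContinuousLinearMap.id ℝ _)) =ᶠ[𝓝 y]
      fun _ ↦ (1 : E →L[ℝ] E) := by
    filter_upwards [hφ.continuousAt (chart_source_mem_nhds E (φ y))] with y' hy'
    exact endCoord_id hy'
  rw [hasCovDerivAt_iff]
  refine ⟨hφ, mdifferentiableAt_const.congr_of_eventuallyEq h, fun X ↦ ?_⟩
  rw [mvfderiv_congr h, mvfderiv_const, zero_apply, zero_add, map_zero,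
    endCoord_id (mem_chart_source E (φ y))]
  exact (show _ * 1 - 1 * _ = (0 : E →L[ℝ] E) by rw [mul_one, one_mul, sub_self]).symm

lemma hasCovDerivAt_endCov {A : Π x : M, EndT E x} {p : M}
    (hA : MDifferentiableAt 𝓘(ℝ, E) (endModel E) (secMap A) p) :
    HasCovDerivAt D (fun x ↦ x) A p (fun X : TangentSpace 𝓘(ℝ, E) p ↦ endCov D A p X) := by
  refine hasCovDerivAt_iff.2
    ⟨mdifferentiableAt_id, (mdifferentiableAt_secAlong.1 hA).2, fun X ↦ ?_⟩
  exact (endCoord_endCov D hA X).trans congr(_ + endConnForm D p ($(mfderiv_id.symm) X) _)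

lemma hasCovDerivAt_pullback {A : Π x : M, EndT E x}
    (hA : MDifferentiableAt 𝓘(ℝ, E) (endModel E) (secMap A) (φ y))
    (hφ : MDifferentiableAt I 𝓘(ℝ, E) φ y) :
    HasCovDerivAt D φ (fun y' ↦ A (φ y')) y
      (fun X ↦ endCov D A (φ y) (mfderiv I 𝓘(ℝ, E) φ y X)) :=
  (hasCovDerivAt_endCov hA).comp_map hφ

lemma hasCovDerivAt_verticalPart (z : EndBundle E M) :
    HasCovDerivAt D TotalSpace.proj (fun w ↦ w.2) z (verticalPart D z) where
  mdifferentiableAt := mdifferentiableAt_id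
  verticalPart_mfderiv U := congrArg (verticalPart D z) congr($(mfderiv_id) U)

lemma HasCovDerivAt.pullbackCov_twistorSpace {Q : Π x : M, Submodule ℝ (EndT E x)}
    {z : EndBundle E M} {σ : Π w : EndBundle E M, EndT E w.proj}
    {σ' : TangentSpace (endModel E) z → EndT E z.proj}
    (hσ : HasCovDerivAt D TotalSpace.proj σ z σ') {U : TangentSpace (endModel E) z}
    (hU : U ∈ twistorTangent Q z) : pullbackCov D (twistorSpace Q) σ z U = σ' U := by
  rw [hasCovDerivAt_iff] at hσ
  refine endCoord_injective _ ((endCoord_pullbackCov D _ σ U).trans ?_)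
  rw [mvfderivWithin_twistorSpace hσ.2.1 hU]
  exact (hσ.2.2 U).symm

end CovAlong

section SphereCurve

variable {ι : Type*} [Fintype ι]

/-- The great circle through `u` with velocity `w`, up to reparametrization: the radial projection
to the unit sphere of the line `t ↦ u + t w`, for a unit vector `u` orthogonal to `w`. -/
def sphereCurve (u w : ι → ℝ) (t : ℝ) : ι → ℝ := (√(1 + t ^ 2 * (w ⬝ᵥ w)))⁻¹ • (u + t • w)

lemma one_add_sq_mul_dotProduct_self_pos (w : ι → ℝ) (t : ℝ) : 0 < 1 + t ^ 2 * (w ⬝ᵥ w) :=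
  add_pos_of_pos_of_nonneg one_pos (mul_nonneg (sq_nonneg t)
    (Finset.sum_nonneg fun i _ ↦ mul_self_nonneg (w i)))

lemma sphereCurve_zero (u w : ι → ℝ) : sphereCurve u w 0 = u := by
  simp [sphereCurve]

lemma sphereCurve_dotProduct_self {u w : ι → ℝ} (hu : u ⬝ᵥ u = 1) (huw : u ⬝ᵥ w = 0) (t : ℝ) :
    sphereCurve u w t ⬝ᵥ sphereCurve u w t = 1 := by
  have hpos := one_add_sq_mul_dotProduct_self_pos w t
  have hline : (u + t • w) ⬝ᵥ (u + t • w) = 1 + t ^ 2 * (w ⬝ᵥ w) := by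
    simp only [add_dotProduct, dotProduct_add, smul_dotProduct, dotProduct_smul, hu, huw,
      dotProduct_comm w u, smul_eq_mul]
    ring
  rw [sphereCurve, smul_dotProduct, dotProduct_smul, hline, smul_smul, ← mul_inv,
    Real.mul_self_sqrt hpos.le, smul_eq_mul, inv_mul_cancel₀ hpos.ne']

lemma contDiff_sphereCurve (u w : ι → ℝ) : ContDiff ℝ ∞ (sphereCurve u w) := by
  have hpos := one_add_sq_mul_dotProduct_self_pos w
  refine ContDiff.smul (ContDiff.inv (ContDiff.sqrt ?_ fun t ↦ (hpos t).ne')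
    fun t ↦ (Real.sqrt_pos.2 (hpos t)).ne') ?_ <;> fun_prop

lemma hasDerivAt_sphereCurve (u w : ι → ℝ) : HasDerivAt (sphereCurve u w) w 0 := by
  have hnorm : HasDerivAt (fun t : ℝ ↦ (√(1 + t ^ 2 * (w ⬝ᵥ w)))⁻¹) 0 0 := by
    have hsq := (((hasDerivAt_pow 2 (0 : ℝ)).mul_const (w ⬝ᵥ w)).const_add 1).sqrt
      (one_add_sq_mul_dotProduct_self_pos w 0).ne'
    simpa using hsq.fun_inv (by simp)
  simpa using! hnorm.smul (((hasDerivAt_id (0 : ℝ)).smul_const w).const_add u)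

end SphereCurve

section Curves

variable {E : Type*} [NormedAddCommGroup E] [NormedSpace ℝ E]
  {M : Type*} [TopologicalSpace M] [ChartedSpace E M] [IsManifold 𝓘(ℝ, E) ∞ M]

lemma exists_contMDiffAt_mfderiv_eq (p : M) (v : E) : ∃ m : ℝ → M,
    ContMDiffAt 𝓘(ℝ, ℝ) 𝓘(ℝ, E) ∞ m 0 ∧ m 0 = p ∧
      (mfderiv 𝓘(ℝ, ℝ) 𝓘(ℝ, E) m 0 (1 : ℝ) : E) = v := by
  let line (t : ℝ) : E := extChartAt 𝓘(ℝ, E) p p + t • v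
  have hline : ContDiff ℝ ∞ line := by fun_prop
  have hline_zero : line 0 = extChartAt 𝓘(ℝ, E) p p := by simp [line]
  have hline' : HasDerivAt line v 0 := by
    simpa [line] using ((hasDerivAt_id (0 : ℝ)).smul_const v).const_add (extChartAt 𝓘(ℝ, E) p p)
  have hchart : ContMDiffAt 𝓘(ℝ, E) 𝓘(ℝ, E) ∞ (extChartAt 𝓘(ℝ, E) p).symm (line 0) :=
    hline_zero ▸ (contMDiffOn_extChartAt_symm p).contMDiffAt (extChartAt_target_mem_nhds p)
  have hchart' : mfderiv 𝓘(ℝ, E) 𝓘(ℝ, E) (extChartAt 𝓘(ℝ, E) p).symm (line 0) =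
      ContinuousLinearMap.id ℝ E := by
    have h := mfderivWithin_range_extChartAt_symm (I := 𝓘(ℝ, E)) (x := p)
    rw [modelWithCornersSelf_coe, range_id, mfderivWithin_univ] at h
    rw [hline_zero]
    exact h
  refine ⟨(extChartAt 𝓘(ℝ, E) p).symm ∘ line, hchart.comp 0 hline.contMDiff.contMDiffAt, ?_, ?_⟩
  · rw [Function.comp_apply, hline_zero, extChartAt_to_inv]
  · refine (mfderiv_comp_apply 0 (hchart.mdifferentiableAt (by simp))
      (hline.contMDiff.contMDiffAt.mdifferentiableAt (by simp)) (1 : ℝ)).trans ?_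
    rw [hchart', mfderiv_eq_fderiv]
    exact hline'.deriv

variable [FiniteDimensional ℝ E]
  {D : CovariantDerivative 𝓘(ℝ, E) E (TangentSpace 𝓘(ℝ, E) : M → Type _)}

lemma hasCovDerivAt_sum_smul_curve {ι : Type*} [Fintype ι] {J : ι → Π x : M, EndT E x}
    {m : ℝ → M} {t : ℝ} (hm : MDifferentiableAt 𝓘(ℝ, ℝ) 𝓘(ℝ, E) m t)
    (hJ : ∀ i, MDifferentiableAt 𝓘(ℝ, E) (endModel E) (secMap (J i)) (m t))
    {s : ℝ → ι → ℝ} {s' : ι → ℝ} (hs : HasDerivAt s s' t) :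
    HasCovDerivAt (I := 𝓘(ℝ, ℝ)) D m (fun r ↦ ∑ i, s r i • J i (m r)) t (fun c : ℝ ↦
      ∑ i, ((c * s' i) • J i (m t) +
        s t i • endCov D (J i) (m t) (mfderiv 𝓘(ℝ, ℝ) 𝓘(ℝ, E) m t c))) := by
  have hsi (i : ι) : HasMFDerivAt 𝓘(ℝ, ℝ) 𝓘(ℝ, ℝ) (fun r ↦ s r i) t
      (ContinuousLinearMap.toSpanSingleton ℝ (s' i)) :=
    hasMFDerivAt_iff_hasFDerivAt.2 (hasDerivAt_pi.1 hs i)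
  have hsi' (i : ι) (c : TangentSpace 𝓘(ℝ, ℝ) t) :
      mvfderiv 𝓘(ℝ, ℝ) (fun r ↦ s r i) t c = (show ℝ from c) * s' i :=
    congr($((hsi i).mfderiv) c)
  simpa only [hsi'] using! HasCovDerivAt.sum (u := Finset.univ) hm fun i _ ↦
    (hasCovDerivAt_pullback (D := D) (hJ i) hm).smul (hsi i).mdifferentiableAt

end Curves

section TwistorTangent

variable {E : Type*} [NormedAddCommGroup E] [NormedSpace ℝ E]
  {M : Type*} [TopologicalSpace M] [ChartedSpace E M]
  {F : Type*} [NormedAddCommGroup F] [NormedSpace ℝ F] {H : Type*} [TopologicalSpace H]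
  {I : ModelWithCorners ℝ F H} {N : Type*} [TopologicalSpace N] [ChartedSpace H N]

variable {Q : Π x : M, Submodule ℝ (EndT E x)}

lemma IsAdmissibleBasis.sum_smul_mem_twistorSpace {x : M} {J : Fin 3 → EndT E x}
    (hJ : IsAdmissibleBasis (Q x) J) {u : Fin 3 → ℝ} (hu : u ⬝ᵥ u = 1) :
    (⟨x, ∑ i, u i • J i⟩ : EndBundle E M) ∈ twistorSpace Q := by
  have hmem : ∑ i, u i • J i ∈ Q x := sum_mem fun i _ ↦ Submodule.smul_mem _ _ (hJ.mem i)
  refine ⟨hmem, ?_⟩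
  have h := hJ.isQuaternionicTriple.sum_smul_mul_self u
  rw [hu, neg_one_smul] at h
  exact h

lemma sub_mem_theta {z : EndBundle E M} {B C : EndT E z.proj} (hB : B ∈ theta Q z)
    (hC : C ∈ theta Q z) : B - C ∈ theta Q z := by
  refine ⟨sub_mem hB.1 hC.1, ?_⟩
  rw [ContinuousLinearMap.sub_comp, ContinuousLinearMap.comp_sub, hB.2, hC.2, neg_sub_neg, neg_sub]

variable [IsManifold 𝓘(ℝ, E) ∞ M]

lemma normTrace_endCoord {p x : M} (hx : x ∈ (chartAt E p).source) (T : EndT E x) :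
    normTrace E (endCoord p x T) = normTrace E T := by
  refine (normTrace_mul_comm (V := E) (tanCoord p x) (T ∘L tanCoordSymm p x)).trans
    (congrArg (normTrace E) ?_)
  ext v
  exact congrArg T (tanCoordSymm_tanCoord hx v)

variable [FiniteDimensional ℝ E]

/-- `D` preserves `Q`: it maps local sections of `Q` to `Q`-valued `1`-forms. -/
def PreservesSections (Q : Π x : M, Submodule ℝ (EndT E x))
    (D : CovariantDerivative 𝓘(ℝ, E) E (TangentSpace 𝓘(ℝ, E) : M → Type _)) : Prop :=
  ∀ (U : Set M) (A : Π x : M, EndT E x), IsOpen U → IsSmoothSectionOn Q A U →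
    ∀ x ∈ U, ∀ X : TangentSpace 𝓘(ℝ, E) x, endCov D A x X ∈ Q x

variable {D : CovariantDerivative 𝓘(ℝ, E) E (TangentSpace 𝓘(ℝ, E) : M → Type _)}
  {φ : N → M} {s t : Π y : N, EndT E (φ y)} {y : N} {s' : TangentSpace I y → EndT E (φ y)}

lemma mdifferentiableAt_metricQ
    (hs : MDifferentiableAt I (endModel E) (secAlong φ s) y)
    (ht : MDifferentiableAt I (endModel E) (secAlong φ t) y) :
    MDifferentiableAt I 𝓘(ℝ) (fun y' ↦ metricQ (s y') (t y')) y := by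
  rw [mdifferentiableAt_secAlong] at hs ht
  have h : (fun y' ↦ metricQ (s y') (t y')) =ᶠ[𝓝 y] fun y' ↦
      (normTrace E).toContinuousLinearMap
        (endCoord (φ y) (φ y') (s y') * endCoord (φ y) (φ y') (t y')) := by
    filter_upwards [hs.1.continuousAt (chart_source_mem_nhds E (φ y))] with y' hy'
    rw [metricQ_eq_normTrace, ← endCoord_comp hy']
    exact (normTrace_endCoord hy' _).symm
  refine MDifferentiableAt.congr_of_eventuallyEq ?_ h
  exact (ContinuousLinearMap.mdifferentiableAt _).comp y (hs.2.mul ht.2)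

variable [Nontrivial E]

lemma HasCovDerivAt.mem (hQ : IsAlmostQuaternionic Q) (hD : PreservesSections Q D)
    (hs : HasCovDerivAt D φ s y s') (hsQ : ∀ᶠ y' in 𝓝 y, s y' ∈ Q (φ y'))
    (X : TangentSpace I y) : s' X ∈ Q (φ y) := by
  obtain ⟨V, hV, hyV, J, hJV, hJ⟩ := hQ (φ y)
  have hφ : MDifferentiableAt I 𝓘(ℝ, E) φ y := (mdifferentiableAt_secAlong.1 hs.1).1
  have hJy (i : Fin 3) := hasCovDerivAt_pullback (D := D)
    (((hJV i).contMDiffAt (hV.mem_nhds hyV)).mdifferentiableAt (by simp)) hφ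
  have hsum : HasCovDerivAt D φ (fun y' ↦ ∑ i, metricQ (s y') (J i (φ y')) • J i (φ y')) y _ :=
    HasCovDerivAt.sum (u := Finset.univ) hφ fun i _ ↦
      (hJy i).smul (mdifferentiableAt_metricQ hs.1 (hJy i).1)
  have hexpand : ∀ᶠ y' in 𝓝 y, ∑ i, metricQ (s y') (J i (φ y')) • J i (φ y') = s y' := by
    filter_upwards [hsQ, hφ.continuousAt (hV.mem_nhds hyV)] with y' hy' hyV'
    exact ((hJ _ hyV').eq_sum_metricQ_smul hy').symm
  rw [hs.unique (hsum.congr_of_eventuallyEq hexpand)]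
  refine Submodule.sum_mem _ fun i _ ↦ Submodule.add_mem _ ?_ ?_ <;>
    refine Submodule.smul_mem _ _ ?_
  · exact (hJ _ hyV).mem i
  · exact hD V (J i) hV ⟨hJV i, fun x hx ↦ (hJ x hx).mem i⟩ _ hyV _

lemma HasCovDerivAt.mem_theta (hQ : IsAlmostQuaternionic Q) (hD : PreservesSections Q D)
    (hs : HasCovDerivAt D φ s y s') (hsZ : ∀ᶠ y' in 𝓝 y, secAlong φ s y' ∈ twistorSpace Q)
    (X : TangentSpace I y) : s' X ∈ theta Q (secAlong φ s y) := by
  refine ⟨hs.mem hQ hD (hsZ.mono fun y' hy' ↦ hy'.1) X, ?_⟩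
  have hφ : MDifferentiableAt I 𝓘(ℝ, E) φ y := (mdifferentiableAt_secAlong.1 hs.1).1
  have hneg : HasCovDerivAt D φ (fun y' ↦ s y' ∘L s y') y _ :=
    ((hasCovDerivAt_id hφ).smul (c := fun _ ↦ -1) mdifferentiableAt_const).congr_of_eventuallyEq
      (hsZ.mono fun y' hy' ↦ (neg_one_smul ℝ _).trans hy'.2.symm)
  have h := congrFun ((hs.comp hs).unique hneg) X
  simp only [mvfderiv_const, zero_apply, zero_smul, smul_zero, add_zero] at h
  exact eq_neg_of_add_eq_zero_right h

lemma verticalPart_mem_theta (hQ : IsAlmostQuaternionic Q) (hD : PreservesSections Q D)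
    {z : EndBundle E M} {U : TangentSpace (endModel E) z} (hU : U ∈ twistorTangent Q z) :
    verticalPart D z U ∈ theta Q z := by
  obtain ⟨c, hc, hcZ, rfl, rfl⟩ := hU
  exact ((hasCovDerivAt_verticalPart (D := D) (c 0)).comp_map
    (hc.mdifferentiableAt (by simp))).mem_theta hQ hD hcZ (1 : ℝ)

lemma exists_secAlong_mem_twistorSpace (hQ : IsAlmostQuaternionic Q) (hD : PreservesSections Q D)
    {m : ℝ → M} (hm : ContMDiffAt 𝓘(ℝ, ℝ) 𝓘(ℝ, E) ∞ m 0) {z B : EndT E (m 0)}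
    (hz : (⟨m 0, z⟩ : EndBundle E M) ∈ twistorSpace Q) (hB : B ∈ theta Q ⟨m 0, z⟩) :
    ∃ s : Π t : ℝ, EndT E (m t), ContMDiffAt 𝓘(ℝ, ℝ) (endModel E) ∞ (secAlong m s) 0 ∧
      (∀ᶠ t in 𝓝 0, secAlong m s t ∈ twistorSpace Q) ∧ s 0 = z ∧
      verticalPart D (secAlong m s 0)
        (mfderiv 𝓘(ℝ, ℝ) (endModel E) (secAlong m s) 0 (1 : ℝ)) = B := by
  obtain ⟨V, hV, hpV, J, hJV, hJ⟩ := hQ (m 0)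
  have hm' := hm.mdifferentiableAt (by simp)
  have hJp (i : Fin 3) : ContMDiffAt 𝓘(ℝ, E) (endModel E) ∞ (secMap (J i)) (m 0) :=
    (hJV i).contMDiffAt (hV.mem_nhds hpV)
  have htriple := (hJ _ hpV).isQuaternionicTriple
  obtain ⟨u, rfl⟩ : ∃ u : Fin 3 → ℝ, z = ∑ i, u i • J i (m 0) :=
    ⟨_, (hJ _ hpV).eq_sum_metricQ_smul hz.1⟩
  have hu : u ⬝ᵥ u = 1 := htriple.dotProduct_self_eq_one hz.2
  have hcov {s : ℝ → Fin 3 → ℝ} {s' : Fin 3 → ℝ} (hs : HasDerivAt s s' 0) :=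
    hasCovDerivAt_sum_smul_curve (D := D) hm' (fun i ↦ (hJp i).mdifferentiableAt (by simp)) hs
  have hmem {s : ℝ → Fin 3 → ℝ} (hs : ∀ t, s t ⬝ᵥ s t = 1) :
      ∀ᶠ t in 𝓝 0, secAlong m (fun t ↦ ∑ i, s t i • J i (m t)) t ∈ twistorSpace Q := by
    filter_upwards [hm'.continuousAt (hV.mem_nhds hpV)] with t ht
    exact (hJ _ ht).sum_smul_mem_twistorSpace (hs t)
  have hC := (hcov (hasDerivAt_const 0 u)).mem_theta hQ hD (hmem fun _ ↦ hu) (1 : ℝ)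
  simp only [Pi.zero_apply, mul_zero, zero_smul, zero_add] at hC
  set C := ∑ i, u i • endCov D (J i) (m 0) (mfderiv 𝓘(ℝ, ℝ) 𝓘(ℝ, E) m 0 (1 : ℝ)) with hC_def
  have hBC : B - C ∈ theta Q ⟨m 0, ∑ i, u i • J i (m 0)⟩ := sub_mem_theta hB hC
  obtain ⟨w, hw⟩ : ∃ w : Fin 3 → ℝ, B - C = ∑ i, w i • J i (m 0) :=
    ⟨_, (hJ _ hpV).eq_sum_metricQ_smul hBC.1⟩
  have huw : u ⬝ᵥ w = 0 := htriple.dotProduct_eq_zero (hw ▸ hBC.2)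
  refine ⟨fun t ↦ ∑ i, sphereCurve u w t i • J i (m t), ?_,
    hmem (sphereCurve_dotProduct_self hu huw), by simp only [sphereCurve_zero], ?_⟩
  · refine contMDiffAt_secAlong_sum hm fun i _ ↦ contMDiffAt_secAlong_smul ?_ ((hJp i).comp 0 hm)
    exact (contDiff_pi.1 (contDiff_sphereCurve u w) i).contMDiff.contMDiffAt
  · refine ((hcov (hasDerivAt_sphereCurve u w)).verticalPart_mfderiv (1 : ℝ)).trans ?_
    simp only [one_mul, sphereCurve_zero, Finset.sum_add_distrib, ← hw, ← hC_def, sub_add_cancel]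

theorem mem_twistorTangent (hQ : IsAlmostQuaternionic Q) (hD : PreservesSections Q D)
    {z : EndBundle E M} (hz : z ∈ twistorSpace Q) {U : TangentSpace (endModel E) z}
    (hU : verticalPart D z U ∈ theta Q z) : U ∈ twistorTangent Q z := by
  obtain ⟨p, z⟩ := z
  obtain ⟨m, hm, rfl, hmU⟩ := exists_contMDiffAt_mfderiv_eq (E := E) p (projDeriv ⟨p, z⟩ U)
  obtain ⟨s, hs, hsZ, rfl, hsU⟩ := exists_secAlong_mem_twistorSpace hQ hD hm hz hU
  refine ⟨secAlong m s, hs, hsZ, rfl, eq_of_projDeriv_eq_of_verticalPart_eq D ?_ hsU⟩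
  exact (projDeriv_mfderiv (z := secAlong m s 0) rfl (hs.mdifferentiableAt (by simp)) _).trans hmU

end TwistorTangent

section DistinguishedSection

variable {E : Type*} [NormedAddCommGroup E] [NormedSpace ℝ E]
  {M : Type*} [TopologicalSpace M] [ChartedSpace E M] {Q : Π x : M, Submodule ℝ (EndT E x)}
  {A : Π x : M, EndT E x} {z : EndBundle E M}

lemma IsAlmostQuaternionic.exists_isAdmissibleBasis [IsManifold 𝓘(ℝ, E) ∞ M]
    (hQ : IsAlmostQuaternionic Q) (x : M) : ∃ J : Fin 3 → EndT E x, IsAdmissibleBasis (Q x) J := by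
  obtain ⟨V, -, hxV, J, -, hJ⟩ := hQ x
  exact ⟨_, hJ x hxV⟩

lemma distinguishedSection_mem_theta {J : Fin 3 → EndT E z.proj}
    (hJ : IsAdmissibleBasis (Q z.proj) J) (hz : z ∈ twistorSpace Q) (hA : A z.proj ∈ Q z.proj) :
    distinguishedSection A z ∈ theta Q z := by
  refine ⟨Submodule.smul_mem _ _ (add_mem hA ?_),
    antilinearPart_mul_self (R := E →L[ℝ] E) hz.2 (A z.proj)⟩
  have hz' := hz.1
  rw [← hJ.span_eq] at hz' hA ⊢
  exact hJ.isQuaternionicTriple.mul_mul_mem_span (R := E →L[ℝ] E) hz' hA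

lemma comp_mem_theta [Nontrivial E] {J : Fin 3 → EndT E z.proj}
    (hJ : IsAdmissibleBasis (Q z.proj) J) (hz : z ∈ twistorSpace Q) {B : EndT E z.proj}
    (hB : B ∈ theta Q z) : z.2 ∘L B ∈ theta Q z := by
  refine ⟨?_, ?_⟩
  · have hz' := hz.1
    have hB' := hB.1
    rw [← hJ.span_eq] at hz' hB' ⊢
    exact hJ.isQuaternionicTriple.mul_mem_span (R := E →L[ℝ] E) hz' hB' hB.2
  · rw [ContinuousLinearMap.comp_assoc, hB.2, ContinuousLinearMap.comp_neg]

variable [IsManifold 𝓘(ℝ, E) ∞ M]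

lemma contMDiffAt_distinguishedSection
    (hA : ContMDiffAt 𝓘(ℝ, E) (endModel E) ∞ (secMap A) z.proj) :
    ContMDiffAt (endModel E) (endModel E) ∞
      (secAlong TotalSpace.proj (distinguishedSection A)) z := by
  have hA' : ContMDiffAt (endModel E) (endModel E) ∞
      (secAlong TotalSpace.proj fun w : EndBundle E M ↦ A w.proj) z :=
    hA.comp z (contMDiffAt_proj (EndT E : M → Type _))
  have hτ : ContMDiffAt (endModel E) (endModel E) ∞
      (secAlong TotalSpace.proj fun w : EndBundle E M ↦ w.2) z := contMDiffAt_id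
  exact contMDiffAt_secAlong_smul contMDiffAt_const (contMDiffAt_secAlong_add hA'
    (contMDiffAt_secAlong_comp hτ (contMDiffAt_secAlong_comp hA' hτ)))

variable [FiniteDimensional ℝ E]
  {D : CovariantDerivative 𝓘(ℝ, E) E (TangentSpace 𝓘(ℝ, E) : M → Type _)}

lemma hasCovDerivAt_distinguishedSection
    (hA : MDifferentiableAt 𝓘(ℝ, E) (endModel E) (secMap A) z.proj) :
    HasCovDerivAt D TotalSpace.proj (distinguishedSection A) z fun U ↦
      thetaProj z (endCov D A z.proj (projDeriv z U)) +
        (2⁻¹ : ℝ) • (z.2 ∘L A z.proj ∘L verticalPart D z U +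
          verticalPart D z U ∘L A z.proj ∘L z.2) := by
  have hA' : HasCovDerivAt D TotalSpace.proj (fun w : EndBundle E M ↦ A w.proj) z
      fun U ↦ endCov D A z.proj (projDeriv z U) :=
    hasCovDerivAt_pullback hA (mdifferentiableAt_proj (EndT E : M → Type _))
  have hτ := hasCovDerivAt_verticalPart (D := D) z
  have h := (hA'.add (hτ.comp (hA'.comp hτ))).smul
    (mdifferentiableAt_const (c := (2⁻¹ : ℝ)))
  refine ⟨h.mdifferentiableAt, fun U ↦ (h.verticalPart_mfderiv U).trans ?_⟩
  rw [mvfderiv_const, zero_apply, zero_smul, zero_add, thetaProj, ← smul_add,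
    ContinuousLinearMap.comp_add]
  congr 1
  abel

lemma thetaCov_distinguishedSection
    (hA : MDifferentiableAt 𝓘(ℝ, E) (endModel E) (secMap A) z.proj) (hz : z ∈ twistorSpace Q)
    {U : TangentSpace (endModel E) z} (hU : U ∈ twistorTangent Q z) :
    thetaCov Q D (distinguishedSection A) z U =
      thetaProj z (endCov D A z.proj (projDeriv z U)) +
        (2⁻¹ : ℝ) • thetaProj z (z.2 ∘L A z.proj ∘L verticalPart D z U +
          verticalPart D z U ∘L A z.proj ∘L z.2) := by
  rw [thetaCov, (hasCovDerivAt_distinguishedSection hA).pullbackCov_twistorSpace hU]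
  let P := antilinearPart (R := E →L[ℝ] E) z.2
  change P (_ + (2⁻¹ : ℝ) • _) = _
  refine (map_add P _ _).trans (congrArg₂ _ ?_ (map_smul P _ _))
  exact antilinearPart_eq_self (R := E →L[ℝ] E) hz.2
    (antilinearPart_mul_self (R := E →L[ℝ] E) hz.2 _)

variable [Nontrivial E]

lemma twistorJ_mem_twistorTangent (hQ : IsAlmostQuaternionic Q) (hD : PreservesSections Q D)
    (hz : z ∈ twistorSpace Q) {U : TangentSpace (endModel E) z} (hU : U ∈ twistorTangent Q z) :
    twistorJ D z U ∈ twistorTangent Q z := by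
  obtain ⟨J, hJ⟩ := hQ.exists_isAdmissibleBasis z.proj
  refine mem_twistorTangent hQ hD hz ?_
  rw [verticalPart_twistorJ]
  exact comp_mem_theta hJ hz (verticalPart_mem_theta hQ hD hU)

lemma horizontalLift_mem_twistorTangent (hQ : IsAlmostQuaternionic Q)
    (hD : PreservesSections Q D) (hz : z ∈ twistorSpace Q) (X : TangentSpace 𝓘(ℝ, E) z.proj) :
    horizontalLift D z X ∈ twistorTangent Q z := by
  refine mem_twistorTangent hQ hD hz ?_
  rw [verticalPart_horizontalLift]
  exact ⟨zero_mem _, by simp⟩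

theorem dbar_distinguishedSection (hQ : IsAlmostQuaternionic Q) (hD : PreservesSections Q D)
    (hA : MDifferentiableAt 𝓘(ℝ, E) (endModel E) (secMap A) z.proj) (hz : z ∈ twistorSpace Q)
    {U : TangentSpace (endModel E) z} (hU : U ∈ twistorTangent Q z) :
    dbar Q D (distinguishedSection A) z U = (2⁻¹ : ℝ) •
      (thetaProj z (endCov D A z.proj (projDeriv z U)) +
        z.2 ∘L thetaProj z (endCov D A z.proj (z.2 (projDeriv z U)))) := by
  have hvert : thetaProj z (z.2 ∘L A z.proj ∘L verticalPart D z U +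
      verticalPart D z U ∘L A z.proj ∘L z.2) +
      z.2 ∘L thetaProj z (z.2 ∘L A z.proj ∘L z.2 ∘L verticalPart D z U +
        (z.2 ∘L verticalPart D z U) ∘L A z.proj ∘L z.2) = 0 :=
    antilinearPart_vertical_eq_zero (R := E →L[ℝ] E) hz.2 (A z.proj)
      (verticalPart_mem_theta hQ hD hU).2
  rw [dbar, thetaCov_distinguishedSection hA hz hU, thetaCov_distinguishedSection hA hz
    (twistorJ_mem_twistorTangent hQ hD hz hU), projDeriv_twistorJ, verticalPart_twistorJ,
    ContinuousLinearMap.comp_add, ContinuousLinearMap.comp_smul, add_add_add_comm, ← smul_add,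
    hvert, smul_zero, add_zero]

theorem isHolomorphicSection_distinguishedSection_iff (hQ : IsAlmostQuaternionic Q)
    (hD : PreservesSections Q D) (hA : IsSmoothSectionOn Q A univ) :
    IsHolomorphicSection Q D (distinguishedSection A) ↔ ∀ z ∈ twistorSpace Q, ∀ X,
      thetaProj z (endCov D A z.proj X) + z.2 ∘L thetaProj z (endCov D A z.proj (z.2 X)) = 0 := by
  have hA' (x : M) : ContMDiffAt 𝓘(ℝ, E) (endModel E) ∞ (secMap A) x := contMDiffOn_univ.1 hA.1 x
  have hdbar {z : EndBundle E M} (hz : z ∈ twistorSpace Q) {U : TangentSpace (endModel E) z} :=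
    dbar_distinguishedSection (U := U) hQ hD ((hA' z.proj).mdifferentiableAt (by simp)) hz
  refine ⟨fun h z hz X ↦ ?_, fun h ↦ ⟨fun z hz ↦ ?_, fun z _ ↦ ?_, fun z hz U hU ↦ ?_⟩⟩
  · have hX := horizontalLift_mem_twistorTangent hQ hD hz X
    have hzero := h.dbar_eq_zero z hz _ hX
    rwa [hdbar hz hX, projDeriv_horizontalLift, smul_eq_zero_iff_right (by norm_num)] at hzero
  · obtain ⟨J, hJ⟩ := hQ.exists_isAdmissibleBasis z.proj
    exact distinguishedSection_mem_theta hJ hz (hA.2 _ (mem_univ _))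
  · exact (contMDiffAt_distinguishedSection (hA' z.proj)).contMDiffWithinAt
  · rw [hdbar hz hU, h z hz, smul_zero]

end DistinguishedSection

end QuatTwistor

end

theorem proposition4p1_general
    {E : Type*} [NormedAddCommGroup E] [NormedSpace ℝ E] [FiniteDimensional ℝ E] [Nontrivial E]
    {M : Type*} [TopologicalSpace M] [ChartedSpace E M] [IsManifold 𝓘(ℝ, E) ∞ M]
    (Q : Π x : M, Submodule ℝ (EndT E x)) (hQ : IsAlmostQuaternionic Q)
    (D : CovariantDerivative 𝓘(ℝ, E) E (TangentSpace 𝓘(ℝ, E) : M → Type _))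
    (hD : PreservesSections Q D)
    (A : Π x : M, EndT E x) (hA : IsSmoothSectionOn Q A Set.univ) :
    IsHolomorphicSection Q D (distinguishedSection A) ↔ IsPenroseSolution Q D A := by
  have hDA (x : M) (X : TangentSpace 𝓘(ℝ, E) x) : endCov D A x X ∈ Q x :=
    hD univ A isOpen_univ hA x (mem_univ x) X
  rw [isHolomorphicSection_distinguishedSection_iff hQ hD hA]
  constructor
  · intro h x J hJ
    exact (hJ.penroseProj_eq_zero_iff _).2 <| (hJ.forall_thetaProj_add_eq_zero_iff (hDA x)).1
      fun z hz hzz ↦ h ⟨x, z⟩ ⟨hz, hzz⟩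
  · intro h z hz
    obtain ⟨J, hJ⟩ := hQ.exists_isAdmissibleBasis z.proj
    exact (hJ.forall_thetaProj_add_eq_zero_iff (hDA z.proj)).2
      ((hJ.penroseProj_eq_zero_iff _).1 (h z.proj J hJ)) z.2 hz.1 hz.2

theorem proposition4p1 {n : ℕ} (hn : 2 ≤ n)
    {E : Type*} [NormedAddCommGroup E] [NormedSpace ℝ E] [FiniteDimensional ℝ E]
    (hE : Module.finrank ℝ E = 4 * n)
    {M : Type*} [TopologicalSpace M] [T2Space M] [SecondCountableTopology M] [ConnectedSpace M]
    [ChartedSpace E M] [IsManifold 𝓘(ℝ, E) ∞ M]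
    (Q : Π x : M, Submodule ℝ (EndT E x)) (hQ : IsAlmostQuaternionic Q)
    (D : CovariantDerivative 𝓘(ℝ, E) E (TangentSpace 𝓘(ℝ, E) : M → Type _))
    (hD : IsQuaternionicConnection Q D) (hsd : IsSelfDual Q D)
    (A : Π x : M, EndT E x) (hA : IsSmoothSectionOn Q A Set.univ) :
    IsHolomorphicSection Q D (distinguishedSection A) ↔ IsPenroseSolution Q D A := by
  have : Nontrivial E := Module.nontrivial_of_finrank_pos (R := ℝ) (by omega)
  exact proposition4p1_general Q hQ D hD.preserves A hA
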